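/- Let $(W,S)$ be a Coxeter system with $W$ finite, let $Q=(q_1,\dots,q_r)$ be a word in $S$ and let $\pi\in W$. The subword complex $\Delta(Q,\pi)$ is the simplicial complex on $[r]=\{1,\dots,r\}$ whose facets are the sets $I\subseteq[r]$ such that the subword of $Q$ formed by the letters at the positions in $[r]\setminus I$ is a reduced expression of $\pi$. Suppose that $\Delta(Q,\pi)$ is spherical, that is, its geometric realization is homeomorphic to a sphere. Then for every vertex $\{i\}\in\Delta(Q,\pi)$ the deletion $$\operatorname{del}(\Delta(Q,\pi),i)=\{J\in\Delta(Q,\pi) : i\notin J\}$$ is vertex decomposable. Here a finite simplicial complex $\Delta$ is (recursively) vertex decomposable if either it is a simplex (the set of all subsets of some finite set), or it is pure (all its facets have the same cardinality) and has a vertex $v$ such that both the deletion $\{J\in\Delta : v\notin J\}$ and the link $\{J\in\Delta : v\notin J,\ J\cup\{v\}\in\Delta\}$ are vertex decomposable. -/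

import Mathlib

namespace SimpComplex

/-- The facets of a simplicial complex, i.e. its maximal faces.  A simplicial complex on the vertex
set `V` is a family of finite subsets of `V` closed under passing to subsets, that is, a term of
`LowerSet (Finset V)`. -/
def IsFacet {V : Type*} (Δ : LowerSet (Finset V)) (F : Finset V) : Prop :=
  F ∈ Δ ∧ ∀ G ∈ Δ, F ⊆ G → G = F

/-- A complex is pure if all its facets have the same dimension. -/
def IsPure {V : Type*} (Δ : LowerSet (Finset V)) : Prop :=
  ∀ F G : Finset V, IsFacet Δ F → IsFacet Δ G → F.card = G.card

/-- The full simplex on the vertex set `F`: its faces are all subsets of `F`. -/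
def simplex {V : Type*} (F : Finset V) : LowerSet (Finset V) where
  carrier := {J | J ⊆ F}
  lower' _ _ hba ha := Finset.Subset.trans hba ha

/-- The deletion of `I`: the faces that do not contain `I`. -/
def deletion {V : Type*} (Δ : LowerSet (Finset V)) (I : Finset V) : LowerSet (Finset V) where
  carrier := {J | J ∈ Δ ∧ ¬ I ⊆ J}
  lower' _ _ hba ha := ⟨Δ.lower hba ha.1, fun h => ha.2 (Finset.Subset.trans h hba)⟩

/-- The link of `I`: the faces `J` disjoint from `I` such that `I ∪ J` is a face. -/
def link {V : Type*} [DecidableEq V] (Δ : LowerSet (Finset V)) (I : Finset V) :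
    LowerSet (Finset V) where
  carrier := {J | J ∈ Δ ∧ I ∪ J ∈ Δ ∧ Disjoint I J}
  lower' _ _ hba ha := ⟨Δ.lower hba ha.1,
    Δ.lower (Finset.union_subset_union_right hba) ha.2.1, ha.2.2.mono_right hba⟩

/-- A complex is vertex decomposable if it is a simplex, or it is pure and has a vertex whose
deletion and link are both vertex decomposable. -/
inductive VertexDecomposable {V : Type*} [DecidableEq V] : LowerSet (Finset V) → Prop
  | of_simplex (F : Finset V) : VertexDecomposable (simplex F)
  | of_vertex (Δ : LowerSet (Finset V)) (v : V) (hpure : IsPure Δ) (hv : {v} ∈ Δ)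
      (hdel : VertexDecomposable (deletion Δ {v})) (hlink : VertexDecomposable (link Δ {v})) :
      VertexDecomposable Δ

/-- The standard geometric realization: the union over the faces `I` of the convex hulls of the
standard basis vectors `e_i`, `i ∈ I`.  It carries the subspace topology. -/
def realization {V : Type*} [DecidableEq V] (Δ : LowerSet (Finset V)) : Set (V → ℝ) :=
  ⋃ I ∈ Δ, convexHull ℝ ((fun i : V => (Pi.single i 1 : V → ℝ)) '' (I : Set V))

/-- A complex on a finite vertex set is spherical if its geometric realization is homeomorphic to
the unit sphere of some `ℝⁿ` (for `n = 0` this is the empty sphere of dimension `-1`). -/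
def IsSpherical {V : Type*} [Fintype V] [DecidableEq V] (Δ : LowerSet (Finset V)) : Prop :=
  ∃ n : ℕ, Nonempty (realization Δ ≃ₜ Metric.sphere (0 : EuclideanSpace ℝ (Fin n)) 1)

end SimpComplex

/-- The subword of `Q` formed by the letters at the positions in `J`, in their order in `Q`. -/
def subwordAt {B : Type*} {r : ℕ} (Q : Fin r → B) (J : Finset (Fin r)) : List B :=
  ((List.finRange r).filter (fun k => k ∈ J)).map Q

/-- `ω` is a reduced expression of `w`. -/
def IsReducedExpression {B W : Type*} [Group W] {M : CoxeterMatrix B} (cs : CoxeterSystem M W)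
    (ω : List B) (w : W) : Prop :=
  cs.wordProd ω = w ∧ cs.IsReduced ω

/-- The subword complex of a word `Q` in the simple generators and a group element `w`: the complex
on the positions of `Q` generated by the sets `I` of positions such that the letters of `Q` outside
`I` form a reduced expression of `w`. -/
def subwordComplex {B W : Type*} [Group W] {M : CoxeterMatrix B} (cs : CoxeterSystem M W)
    {r : ℕ} (Q : Fin r → B) (w : W) : LowerSet (Finset (Fin r)) where
  carrier := {J | ∃ I : Finset (Fin r), J ⊆ I ∧ IsReducedExpression cs (subwordAt Q Iᶜ) w}
  lower' _ _ hba := fun ⟨I, hI, hred⟩ => ⟨I, Finset.Subset.trans hba hI, hred⟩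

namespace CoxeterSystem

variable {B W : Type*} [Group W] {M : CoxeterMatrix B} (cs : CoxeterSystem M W)

/-! ### Strong exchange, from the action of the group on signed reflections. -/

section StrongExchange

open Classical in
/-- The action of a simple reflection on signed elements of `W`, by conjugation, which changes the
sign of that simple reflection only. -/
noncomputable def signedConjFun (i : B) (p : W × ZMod 2) : W × ZMod 2 :=
  (cs.simple i * p.1 * cs.simple i, p.2 + if p.1 = cs.simple i then 1 else 0)

lemma involutive_signedConjFun (i : B) : Function.Involutive (cs.signedConjFun i) := by
  rintro ⟨t, e⟩
  have h : cs.simple i * t * cs.simple i = cs.simple i ↔ t = cs.simple i := by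
    constructor
    · intro h
      have := congrArg (fun x => cs.simple i * x * cs.simple i) h
      simpa [mul_assoc] using this
    · rintro rfl; simp
  ext
  · simp [signedConjFun, mul_assoc]
  · by_cases ht : t = cs.simple i
    · simp [signedConjFun, ht, add_assoc, CharTwo.add_self_eq_zero]
    · simp [signedConjFun, mt h.1 ht, ht]

/-- `signedConjFun` as a permutation. -/
noncomputable def signedConj (i : B) : Equiv.Perm (W × ZMod 2) :=
  (cs.involutive_signedConjFun i).toPerm

lemma signedConj_apply (i : B) (p : W × ZMod 2) : cs.signedConj i p = cs.signedConjFun i p := rfl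

-- Once the action is known to depend only on the product of the word, this makes the parity of the
-- multiplicity of `t` in the right inversion sequence an invariant of the group element.
open Classical in
lemma prod_map_signedConj_apply (ω : List B) (t : W) (e : ZMod 2) :
    (ω.map cs.signedConj).prod (t, e) =
      (cs.wordProd ω * t * (cs.wordProd ω)⁻¹, e + ((cs.rightInvSeq ω).count t : ZMod 2)) := by
  induction ω with
  | nil => simp
  | cons i ω ih =>
    have h : cs.wordProd ω * t * (cs.wordProd ω)⁻¹ = cs.simple i ↔
        (cs.wordProd ω)⁻¹ * cs.simple i * cs.wordProd ω = t := by
      rw [mul_inv_eq_iff_eq_mul, ← eq_inv_mul_iff_mul_eq, eq_comm, mul_assoc]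
    rw [List.map_cons, List.prod_cons, Equiv.Perm.mul_apply, ih]
    simp only [signedConj_apply, signedConjFun, rightInvSeq, List.count_cons,
      wordProd_cons, h, beq_iff_eq]
    ext
    · simp [mul_assoc]
    · push_cast
      rw [add_assoc]

/-- The entries are periodic with period `M i j` because `(s_j s_i) ^ M i j = 1`. Every reflection
therefore occurs an even number of times, which gives the braid relations for `signedConj`. -/
lemma leftInvSeq_alternatingWord_two_mul (i j : B) :
    ∃ l, cs.leftInvSeq (alternatingWord i j (2 * M i j)) = l ++ l := by
  set ω := cs.leftInvSeq (alternatingWord i j (2 * M i j)) with hω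
  have hlen : ω.length = 2 * M i j := by simp [hω]
  refine ⟨ω.take (M i j), ?_⟩
  conv_lhs => rw [← List.take_append_drop (M i j) ω]
  congr 1
  refine List.ext_getElem (by simp [hlen]; omega) fun k h₁ h₂ => ?_
  simp only [List.length_drop, List.length_take, hlen] at h₁ h₂
  rw [List.getElem_drop, List.getElem_take]
  simp only [hω]
  rw [cs.getElem_leftInvSeq_alternatingWord i j _ _ (by omega),
    cs.getElem_leftInvSeq_alternatingWord i j _ _ (by omega),
    prod_alternatingWord_eq_mul_pow, prod_alternatingWord_eq_mul_pow]
  have e1 : (2 * (M i j + k) + 1) / 2 = M i j + k := by omega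
  have e2 : (2 * k + 1) / 2 = k := by omega
  rw [e1, e2, pow_add, M.symmetric i j, cs.simple_mul_simple_pow j i]
  simp

lemma prod_map_alternatingWord_two_mul {G : Type*} [Monoid G] (f : B → G) (i j : B) (m : ℕ) :
    ((alternatingWord i j (2 * m)).map f).prod = (f i * f j) ^ m := by
  induction m with
  | zero => simp [alternatingWord]
  | succ m ih =>
    rw [show 2 * (m + 1) = 2 * m + 1 + 1 by ring, alternatingWord_succ, alternatingWord_succ,
      List.concat_eq_append, List.concat_eq_append]
    simp [ih, pow_succ]

lemma isLiftable_signedConj : M.IsLiftable cs.signedConj := by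
  classical
  intro i j
  rw [← prod_map_alternatingWord_two_mul]
  set ω := alternatingWord i j (2 * M i j) with hω
  -- The generators act by involutions, so reversing the word inverts the product. The right
  -- inversion sequence of the reversed word is governed by the doubled list.
  have hrev : (ω.reverse.map cs.signedConj).prod = ((ω.map cs.signedConj).prod)⁻¹ := by
    rw [List.prod_inv_reverse, List.map_map, List.map_reverse]
    congr 3
  have hone : cs.wordProd ω = 1 := by
    rw [wordProd, hω, prod_map_alternatingWord_two_mul, simple_mul_simple_pow]
  rw [← inv_eq_one, ← hrev]
  ext1 ⟨t, e⟩
  obtain ⟨l, hl⟩ := cs.leftInvSeq_alternatingWord_two_mul i j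
  rw [prod_map_signedConj_apply, rightInvSeq_reverse, wordProd_reverse, hone, hl]
  simp [CharTwo.add_self_eq_zero]

/-- The action of `W` on signed elements by conjugation. -/
noncomputable def signedConjHom : W →* Equiv.Perm (W × ZMod 2) :=
  cs.lift ⟨cs.signedConj, cs.isLiftable_signedConj⟩

lemma signedConjHom_wordProd (ω : List B) :
    cs.signedConjHom (cs.wordProd ω) = (ω.map cs.signedConj).prod := by
  rw [wordProd, map_list_prod, List.map_map]
  congr 2
  ext1 i
  exact cs.lift_apply_simple cs.isLiftable_signedConj i

lemma signedConjHom_apply (w t : W) (e : ZMod 2) :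
    cs.signedConjHom w (t, e) = (w * t * w⁻¹, e + (cs.signedConjHom w (t, 0)).2) := by
  classical
  obtain ⟨ω, -, rfl⟩ := cs.exists_isReduced w
  simp only [signedConjHom_wordProd, prod_map_signedConj_apply, zero_add]

lemma signedConjHom_simple_self (i : B) (e : ZMod 2) :
    cs.signedConjHom (cs.simple i) (cs.simple i, e) = (cs.simple i, e + 1) := by
  have := cs.signedConjHom_wordProd [i]
  rw [wordProd_singleton] at this
  rw [this]
  simp [signedConj_apply, signedConjFun]

/-- Write `t = u s u⁻¹`. The sign changes contributed by `u⁻¹` and `u` cancel, and `s` flips the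
sign of itself once. -/
lemma signedConjHom_self {t : W} (ht : cs.IsReflection t) :
    cs.signedConjHom t (t, 0) = (t, 1) := by
  obtain ⟨u, i, rfl⟩ := ht
  set x := u * cs.simple i * u⁻¹ with hx
  set a := (cs.signedConjHom u⁻¹ (x, 0)).2 with ha
  have h1 : cs.signedConjHom u⁻¹ (x, 0) = (cs.simple i, a) := by
    rw [signedConjHom_apply, ← ha]
    simp [hx, mul_assoc]
  have h2 : cs.signedConjHom u (cs.simple i, a) = (x, 0) := by
    rw [← h1, ← Equiv.Perm.mul_apply, ← map_mul]; simp
  have h3 : cs.signedConjHom u (cs.simple i, a + 1) = (x, 1) := by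
    rw [signedConjHom_apply] at h2 ⊢
    have := (Prod.ext_iff.1 h2).2
    simp only at this
    rw [add_right_comm, this, zero_add]
  conv_lhs => rw [hx, map_mul, map_mul, Equiv.Perm.mul_apply, Equiv.Perm.mul_apply, ← hx, h1,
    signedConjHom_simple_self, h3]

lemma mem_rightInvSeq_of_signedConjHom {ω : List B} {t : W}
    (h : (cs.signedConjHom (cs.wordProd ω) (t, 0)).2 ≠ 0) : t ∈ cs.rightInvSeq ω := by
  classical
  by_contra hmem
  rw [signedConjHom_wordProd, prod_map_signedConj_apply, List.count_eq_zero_of_not_mem hmem] at h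
  simp at h

/-- The strong exchange property. -/
theorem mem_rightInvSeq_of_isRightInversion {ω : List B} {t : W}
    (h : cs.IsRightInversion (cs.wordProd ω) t) : t ∈ cs.rightInvSeq ω := by
  apply cs.mem_rightInvSeq_of_signedConjHom
  intro h0
  -- If the word did not flip the sign of `t`, its product with `t` would. Then `t` would shorten
  -- that product as well as the original element.
  obtain ⟨ω', hred, hω'⟩ := cs.exists_isReduced (cs.wordProd ω * t)
  have hmem : t ∈ cs.rightInvSeq ω' := by
    apply cs.mem_rightInvSeq_of_signedConjHom
    rw [← hω', map_mul, Equiv.Perm.mul_apply, cs.signedConjHom_self h.1, signedConjHom_apply, h0]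
    simp
  have := (cs.isRightInversion_of_mem_rightInvSeq hred hmem).2
  rw [← hω', mul_assoc, h.1.mul_self, mul_one] at this
  exact lt_asymm this h.2

theorem exists_eraseIdx_of_isRightInversion {ω : List B} {t : W}
    (h : cs.IsRightInversion (cs.wordProd ω) t) :
    ∃ j < ω.length, cs.wordProd ω * t = cs.wordProd (ω.eraseIdx j) := by
  obtain ⟨j, hj, rfl⟩ := List.mem_iff_getElem.1 (cs.mem_rightInvSeq_of_isRightInversion h)
  refine ⟨j, by simpa using hj, ?_⟩
  rw [← List.getD_eq_getElem _ 1 hj, wordProd_mul_getD_rightInvSeq]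

theorem exists_eraseIdx_of_isLeftDescent {ω : List B} {i : B}
    (h : cs.IsLeftDescent (cs.wordProd ω) i) :
    ∃ j < ω.length, cs.simple i * cs.wordProd ω = cs.wordProd (ω.eraseIdx j) := by
  set w := cs.wordProd ω with hw
  have hw' : w * (w⁻¹ * cs.simple i * w) = cs.simple i * w := by group
  rw [← hw']
  refine cs.exists_eraseIdx_of_isRightInversion ⟨⟨w⁻¹, i, by simp⟩, ?_⟩
  rw [← hw, hw']
  exact h

end StrongExchange

/-- The lifting property of covers in the Bruhat order. -/
theorem eq_of_cover_of_descent {u r : W} {i : B} (hr : cs.IsReflection r)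
    (hlen : cs.length (u * r) = cs.length u + 1)
    (hdesc : cs.length (u * r * cs.simple i) < cs.length (u * r))
    (hasc : cs.length u < cs.length (u * cs.simple i)) : u * r * cs.simple i = u := by
  obtain ⟨ω, hred, hω⟩ := cs.exists_isReduced (u * r * cs.simple i)
  have hωlen : ω.length = cs.length u := by
    have h1 := (cs.isRightDescent_iff (w := u * r) (i := i)).1 hdesc
    have h2 : cs.length (cs.wordProd ω) = ω.length := hred
    rw [← hω] at h2
    omega
  have hv : cs.wordProd (ω ++ [i]) = u * r := by
    rw [wordProd_append, ← hω]; simp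
  have hu : u * r * r = u := by rw [mul_assoc, hr.mul_self, mul_one]
  obtain ⟨j, hj, he⟩ := cs.exists_eraseIdx_of_isRightInversion (ω := ω ++ [i]) (t := r)
    ⟨hr, by rw [hv, hu]; omega⟩
  rw [hv, hu] at he
  simp only [List.length_append, List.length_singleton] at hj
  -- Erasing a letter of `ω` would make `u * s` shorter than `u`, so the erased letter is the final
  -- `i`.
  rcases Nat.lt_or_ge j ω.length with hj' | hj'
  · rw [List.eraseIdx_append_of_lt_length hj', wordProd_append, wordProd_singleton] at he
    have h3 : u * cs.simple i = cs.wordProd (ω.eraseIdx j) := by rw [he]; simp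
    have h4 := cs.length_wordProd_le (ω.eraseIdx j)
    rw [← h3, List.length_eraseIdx_of_lt hj'] at h4
    omega
  · rw [hω, he, List.eraseIdx_append_of_length_le hj']
    have : j - ω.length = 0 := by omega
    simp [this]

/-! ### Bruhat order and left multiplication by a simple reflection. -/

section Bruhat

/-- A step up in the Bruhat order. -/
def BruhatStep (x y : W) : Prop :=
  ∃ t, cs.IsReflection t ∧ y = x * t ∧ cs.length x < cs.length y

/-- The Bruhat order. -/
def BruhatLE : W → W → Prop := Relation.ReflTransGen cs.BruhatStep

variable {cs}

lemma BruhatLE.trans {x y z : W} (h₁ : cs.BruhatLE x y) (h₂ : cs.BruhatLE y z) :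
    cs.BruhatLE x z := Relation.ReflTransGen.trans h₁ h₂

lemma BruhatLE.eq_or_length_lt {x y : W} (h : cs.BruhatLE x y) :
    x = y ∨ cs.length x < cs.length y := by
  induction h with
  | refl => exact Or.inl rfl
  | tail _ hs ih =>
    obtain ⟨t, -, -, hlt⟩ := hs
    rcases ih with rfl | ih
    · exact Or.inr hlt
    · exact Or.inr (ih.trans hlt)

variable (cs)

lemma bruhatLE_simple_mul {x : W} {i : B} (h : cs.length x < cs.length (cs.simple i * x)) :
    cs.BruhatLE x (cs.simple i * x) :=
  .single ⟨x⁻¹ * cs.simple i * x, ⟨x⁻¹, i, by simp⟩, by group, h⟩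

/-- If `s x < x`, then `s x` lies below `x` and hence below `y`. Otherwise either `s x < s y` is
again a step, or exchange in a reduced word of `s x` must remove its first letter, so that `s x =
y`. -/
lemma BruhatStep.simple_mul {x y : W} (h : cs.BruhatStep x y) (i : B) :
    cs.BruhatLE (cs.simple i * x) y ∨ cs.BruhatLE (cs.simple i * x) (cs.simple i * y) := by
  obtain ⟨t, ht, rfl, hlt⟩ := id h
  rcases lt_or_gt_of_ne (cs.length_simple_mul_ne x i) with hd | ha
  · left
    have := cs.bruhatLE_simple_mul (x := cs.simple i * x) (i := i) (by simpa using hd)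
    rw [simple_mul_simple_cancel_left] at this
    exact this.trans (.single h)
  · rcases lt_or_gt_of_ne (ht.length_mul_left_ne (cs.simple i * x)) with h1 | h1
    · left
      obtain ⟨ω, hred, hω⟩ := cs.exists_isReduced x
      have hv : cs.wordProd (i :: ω) = cs.simple i * x := by rw [wordProd_cons, hω]
      obtain ⟨j, hj, he⟩ := cs.exists_eraseIdx_of_isRightInversion (ω := i :: ω) (t := t)
        ⟨ht, by rwa [hv]⟩
      rw [hv] at he
      rcases j with _ | j
      · rw [List.eraseIdx_cons_zero, ← hω] at he
        have : cs.simple i * x = x * t := by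
          have := congrArg (fun z => cs.simple i * z) he
          simp only [mul_assoc, simple_mul_simple_cancel_left] at this
          exact this.symm
        rw [this]
        exact .refl
      · rw [List.eraseIdx_cons_succ, wordProd_cons, mul_assoc] at he
        have he' := mul_left_cancel he
        have h4 := cs.length_wordProd_le (ω.eraseIdx j)
        simp only [List.length_cons, Nat.add_lt_add_iff_right] at hj
        have h5 : cs.length (cs.wordProd ω) = ω.length := hred
        rw [← he', List.length_eraseIdx_of_lt hj] at h4
        rw [← hω] at h5
        omega
    · right
      exact .single ⟨t, ht, by group, by rwa [← mul_assoc]⟩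

lemma BruhatLE.simple_mul {x y : W} (h : cs.BruhatLE x y) (i : B) :
    cs.BruhatLE (cs.simple i * x) y ∨ cs.BruhatLE (cs.simple i * x) (cs.simple i * y) := by
  induction h using Relation.ReflTransGen.head_induction_on with
  | refl => exact Or.inr .refl
  | head hs hle ih =>
    rcases BruhatStep.simple_mul cs hs i with h1 | h1
    · exact Or.inl (h1.trans hle)
    · exact ih.imp h1.trans h1.trans

end Bruhat

end CoxeterSystem

/-! ### Exchange after inserting a letter into a reduced word. -/

namespace CoxeterSystem

variable {B W : Type*} [Group W] {M : CoxeterMatrix B} (cs : CoxeterSystem M W)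

/-- If inserting `i` in front of the word `y ++ z` destroys reducedness, but inserting it in front
of `y` does not, then `i` can be traded for a letter of `z`. -/
lemma exists_eraseIdx_of_insert {x : W} {i : B} (z : List B) :
    ∀ y : List B, cs.length (x * cs.wordProd (y ++ z)) = cs.length x + (y ++ z).length →
    cs.length (x * cs.simple i * cs.wordProd y) = cs.length x + 1 + y.length →
    cs.length (x * cs.simple i * cs.wordProd (y ++ z)) < cs.length x + 1 + (y ++ z).length →
    ∃ j < z.length, x * cs.simple i * cs.wordProd (y ++ z.eraseIdx j) =
      x * cs.wordProd (y ++ z) := by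
  induction z with
  | nil =>
    intro y _ h2 h3
    simp only [List.append_nil] at h3
    omega
  | cons k z ih =>
    intro y h1 h2 h3
    have hcons : y ++ k :: z = (y ++ [k]) ++ z := by simp
    -- Letters move from `z` to `y` until `k` is the first one to destroy length-additivity. There
    -- `x y` is covered by `x s y`, with `k` an ascent of the former and a descent of the latter, so
    -- the lifting property identifies `x s y k` with `x y`.
    by_cases h : cs.length (x * cs.simple i * cs.wordProd (y ++ [k])) =
        cs.length x + 1 + (y ++ [k]).length
    · rw [hcons] at h1 h3
      obtain ⟨j, hj, he⟩ := ih (y ++ [k]) h1 h h3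
      refine ⟨j + 1, by simpa using hj, ?_⟩
      simpa using he
    · refine ⟨0, by simp, ?_⟩
      have e1 : x * cs.wordProd y * ((cs.wordProd y)⁻¹ * cs.simple i * cs.wordProd y) =
          x * cs.simple i * cs.wordProd y := by group
      have hyk : cs.wordProd (y ++ [k]) = cs.wordProd y * cs.simple k := by
        simp [wordProd_append]
      have hz := cs.length_mul_le (x * cs.wordProd (y ++ [k])) (cs.wordProd z)
      have hz' := cs.length_wordProd_le z
      have hy := cs.length_mul_le x (cs.wordProd y)
      have hy' := cs.length_wordProd_le y
      have hk := cs.length_mul_le (x * cs.wordProd y) (cs.simple k)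
      rw [cs.length_simple] at hk
      rw [hcons, wordProd_append, ← mul_assoc] at h1
      have hu : cs.length (x * cs.wordProd y) = cs.length x + y.length := by
        rw [hyk, ← mul_assoc] at hz
        simp only [List.length_append, List.length_singleton, hyk, ← mul_assoc] at h1
        omega
      have := cs.eq_of_cover_of_descent (u := x * cs.wordProd y)
        (r := (cs.wordProd y)⁻¹ * cs.simple i * cs.wordProd y) (i := k)
        ⟨(cs.wordProd y)⁻¹, i, by simp⟩ (by rw [e1]; omega)
        (by
          rw [e1]
          rcases cs.length_mul_simple (x * cs.simple i * cs.wordProd y) k with h5 | h5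
          · rw [hyk, ← mul_assoc, List.length_append, List.length_singleton] at h
            omega
          · omega)
        (by
          rw [hyk, ← mul_assoc] at hz
          simp only [List.length_append, List.length_singleton, hyk, ← mul_assoc] at h1
          omega)
      rw [e1] at this
      rw [List.eraseIdx_cons_zero, wordProd_append, wordProd_append, wordProd_cons, ← mul_assoc,
        ← mul_assoc, ← mul_assoc, ← this]
      simp

end CoxeterSystem

/-! ### Complexes of length-additive factorizations and their vertex decomposability. -/

namespace SubwordComplex

open SimpComplex

variable {B W V : Type*} [Group W] {M : CoxeterMatrix B} (cs : CoxeterSystem M W) (Q : V → B)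

/-- `a` and `c` are subwords of `A` and `C` whose letters, with an element `m` in between, give a
length-additive factorization of `w`. -/
structure IsFactorization (A : List V) (m : W) (C : List V) (w : W) (a c : List V) : Prop where
  left : a.Sublist A
  right : c.Sublist C
  prod_eq : cs.wordProd (a.map Q) * m * cs.wordProd (c.map Q) = w
  length_eq : a.length + cs.length m + c.length = cs.length w

section IsFactorization

variable {cs Q} {A C a c : List V} {m w : W}

lemma IsFactorization.reverse (h : IsFactorization cs Q A m C w a c) :
    IsFactorization cs Q C.reverse m⁻¹ A.reverse w⁻¹ c.reverse a.reverse where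
  left := h.right.reverse
  right := h.left.reverse
  prod_eq := by
    rw [← h.prod_eq]
    simp [List.map_reverse, CoxeterSystem.wordProd_reverse, mul_assoc]
  length_eq := by
    have := h.length_eq
    simp only [List.length_reverse, CoxeterSystem.length_inv]
    omega

lemma IsFactorization.length_left (h : IsFactorization cs Q A m C w a c) :
    cs.length (cs.wordProd (a.map Q) * m) = a.length + cs.length m := by
  have h1 := cs.length_mul_le (cs.wordProd (a.map Q) * m) (cs.wordProd (c.map Q))
  have h2 := cs.length_mul_le (cs.wordProd (a.map Q)) m
  have h3 := cs.length_wordProd_le (a.map Q)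
  have h4 := cs.length_wordProd_le (c.map Q)
  rw [h.prod_eq, ← h.length_eq] at h1
  simp only [List.length_map] at *
  omega

/-- The inserted reflection `s` must be paid for by a letter. If `s` lengthens `a m`, maximality of
`w` makes `a m s c` non-additive, so exchange removes a letter of `c`. If `s` shortens `a m`,
exchange removes a letter of `a`. Since only letters are dropped, every face avoiding `a` and `c`
still avoids `a'` and `c'`. -/
lemma IsFactorization.exists_of_ascent (h : IsFactorization cs Q A m C w a c) {v : V}
    (hm : cs.length m < cs.length (m * cs.simple (Q v)))
    (H : ∀ w' a c, IsFactorization cs Q A m (v :: C) w' a c → cs.length w' ≤ cs.length w) :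
    ∃ a' c', a'.Sublist a ∧ c'.Sublist c ∧
      IsFactorization cs Q A (m * cs.simple (Q v)) C w a' c' := by
  have hms : cs.length (m * cs.simple (Q v)) = cs.length m + 1 := by
    rcases cs.length_mul_simple m (Q v) with h | h <;> omega
  have hlen := h.length_eq
  by_cases hx : cs.length (cs.wordProd (a.map Q) * m * cs.simple (Q v)) =
      cs.length (cs.wordProd (a.map Q) * m) + 1
  · obtain ⟨j, hj, he⟩ := cs.exists_eraseIdx_of_insert (i := Q v) (c.map Q) []
      (x := cs.wordProd (a.map Q) * m)
      (by rw [List.nil_append, h.prod_eq, h.length_left, List.length_map, h.length_eq])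
      (by simpa using hx)
      (by
        by_contra hcon
        rw [not_lt, List.nil_append, h.length_left, List.length_map] at hcon
        set w' := cs.wordProd (a.map Q) * m * cs.simple (Q v) * cs.wordProd (c.map Q) with hw'
        have hprod : cs.wordProd (a.map Q) * m * cs.wordProd ((v :: c).map Q) = w' := by
          rw [hw', List.map_cons, cs.wordProd_cons, ← mul_assoc]
        have h1 := cs.length_mul_le (cs.wordProd (a.map Q) * m * cs.simple (Q v))
          (cs.wordProd (c.map Q))
        have h2 := cs.length_wordProd_le (c.map Q)
        rw [List.length_map] at h2
        rw [hx, h.length_left, ← hw'] at h1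
        have := H w' a (v :: c) ⟨h.left, h.right.cons_cons v, hprod, by
          rw [List.length_cons]; omega⟩
        omega)
    rw [List.length_map] at hj
    refine ⟨a, c.eraseIdx j, .refl _, List.eraseIdx_sublist _ _, h.left,
      (List.eraseIdx_sublist _ _).trans h.right, ?_, ?_⟩
    · rw [← h.prod_eq]
      simpa [List.eraseIdx_map, mul_assoc] using he
    · rw [List.length_eraseIdx_of_lt hj]
      omega
  · have hd : cs.IsRightInversion (cs.wordProd (a.map Q) * m) (cs.simple (Q v)) := by
      rw [cs.isRightInversion_simple_iff_isRightDescent]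
      by_contra hcon
      exact hx (cs.not_isRightDescent_iff.1 hcon)
    obtain ⟨μ, hred, hμ⟩ := cs.exists_isReduced m
    have hμl : μ.length = cs.length m := by
      rw [hμ]; exact hred.symm
    have hω : cs.wordProd (a.map Q ++ μ) = cs.wordProd (a.map Q) * m := by
      rw [cs.wordProd_append, ← hμ]
    obtain ⟨j, hj, he⟩ := cs.exists_eraseIdx_of_isRightInversion (ω := a.map Q ++ μ) (by rwa [hω])
    rw [hω] at he
    simp only [List.length_append, List.length_map] at hj
    rcases Nat.lt_or_ge j a.length with hj' | hj'
    · rw [List.eraseIdx_append_of_lt_length (by simpa using hj'), cs.wordProd_append, ← hμ] at he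
      refine ⟨a.eraseIdx j, c, List.eraseIdx_sublist _ _, .refl _,
        (List.eraseIdx_sublist _ _).trans h.left, h.right, ?_, ?_⟩
      · rw [← h.prod_eq, ← List.eraseIdx_map, ← mul_assoc, ← he]
        simp
      · rw [List.length_eraseIdx_of_lt hj']
        omega
    -- Removing a letter from the reduced word of `m` would give `m s` shorter than `m`.
    · exfalso
      rw [List.eraseIdx_append_of_length_le (by simpa using hj'), cs.wordProd_append,
        mul_assoc] at he
      have he' := mul_left_cancel he
      have h4 := cs.length_wordProd_le (μ.eraseIdx (j - (a.map Q).length))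
      rw [← he', List.length_eraseIdx_of_lt (by simp; omega)] at h4
      omega

lemma IsFactorization.cons {m' : W} {v : V}
    (hm : cs.length m < cs.length (m * cs.simple (Q v)))
    (hm' : m' = m * cs.simple (Q v)) (h : IsFactorization cs Q A m' C w a c) :
    IsFactorization cs Q A m (v :: C) w a (v :: c) := by
  subst hm'
  refine ⟨h.left, h.right.cons_cons v, ?_, ?_⟩
  · rw [← h.prod_eq, List.map_cons, cs.wordProd_cons]
    simp only [mul_assoc]
  · have h0 := h.length_eq
    rcases cs.length_mul_simple m (Q v) with h | h <;> rw [List.length_cons] <;> omega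

end IsFactorization

lemma deletion_eq_self {Δ : LowerSet (Finset V)} {v : V} (h : {v} ∉ Δ) : deletion Δ {v} = Δ := by
  ext J
  exact ⟨fun hJ => hJ.1, fun hJ => ⟨hJ, fun h' => h (Δ.lower h' hJ)⟩⟩

variable [DecidableEq V]

/-- The complex of all sets of letters of `A` and `C` that are avoided by some length-additive
factorization of `w`. -/
def factorizationComplex (A : List V) (m : W) (C : List V) (w : W) : LowerSet (Finset V) where
  carrier := {J | J ⊆ (A ++ C).toFinset ∧
    ∃ a c, IsFactorization cs Q A m C w a c ∧ ∀ v ∈ J, v ∉ a ∧ v ∉ c}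
  lower' := fun _ _ hba ⟨hJ, a, c, h, hav⟩ => ⟨hba.trans hJ, a, c, h, fun v hv => hav v (hba hv)⟩

variable {cs Q} {A C : List V} {m w : W}

lemma mem_factorizationComplex {J : Finset V} :
    J ∈ factorizationComplex cs Q A m C w ↔ J ⊆ (A ++ C).toFinset ∧
      ∃ a c, IsFactorization cs Q A m C w a c ∧ ∀ v ∈ J, v ∉ a ∧ v ∉ c := Iff.rfl

lemma factorizationComplex_reverse :
    factorizationComplex cs Q C.reverse m⁻¹ A.reverse w⁻¹ = factorizationComplex cs Q A m C w := by
  ext J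
  rw [SetLike.mem_coe, SetLike.mem_coe, mem_factorizationComplex, mem_factorizationComplex]
  have : (C.reverse ++ A.reverse).toFinset = (A ++ C).toFinset := by
    ext; simp [or_comm]
  rw [this]
  refine and_congr_right fun _ => ⟨?_, ?_⟩
  · rintro ⟨a, c, h, hav⟩
    refine ⟨c.reverse, a.reverse, by simpa using h.reverse, fun v hv => ?_⟩
    simpa using (hav v hv).symm
  · rintro ⟨a, c, h, hav⟩
    refine ⟨c.reverse, a.reverse, h.reverse, fun v hv => ?_⟩
    simpa using (hav v hv).symm

/-- A facet is the full complement of the letters used, whose number is always `cs.length w -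
cs.length m`. -/
lemma isPure_factorizationComplex (hnd : (A ++ C).Nodup) :
    IsPure (factorizationComplex cs Q A m C w) := by
  have key : ∀ F, IsFacet (factorizationComplex cs Q A m C w) F →
      F.card = (A ++ C).length - (cs.length w - cs.length m) := by
    rintro F ⟨⟨hF, a, c, h, hav⟩, hmax⟩
    have hsub : (a ++ c).Sublist (A ++ C) := h.left.append h.right
    have hG := hmax ((A ++ C).toFinset \ (a ++ c).toFinset)
      ⟨Finset.sdiff_subset, a, c, h, fun v hv => by simpa using (Finset.mem_sdiff.1 hv).2⟩
      (fun v hv => by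
        have := hav v hv
        have h' := hF hv
        simp only [Finset.mem_sdiff, List.mem_toFinset, List.mem_append] at h' ⊢
        tauto)
    rw [← hG, Finset.card_sdiff_of_subset (fun v hv => by
        simpa using hsub.subset (List.mem_toFinset.1 hv)),
      List.toFinset_card_of_nodup hnd, List.toFinset_card_of_nodup (hnd.sublist hsub)]
    have := h.length_eq
    rw [List.length_append (as := a)]
    omega
  intro F G hF hG
  rw [key F hF, key G hG]

section Cons

variable {v : V}

lemma link_factorizationComplex (hnd : (A ++ v :: C).Nodup) :
    link (factorizationComplex cs Q A m (v :: C) w) {v} = factorizationComplex cs Q A m C w := by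
  have hv : v ∉ A ++ C := (List.nodup_middle.1 hnd).notMem
  ext J
  rw [SetLike.mem_coe, SetLike.mem_coe, mem_factorizationComplex]
  constructor
  · rintro ⟨⟨hJ, -⟩, ⟨-, a, c, h, hav⟩, hdisj⟩
    have hvJ : v ∉ J := by simpa using hdisj
    refine ⟨fun u hu => ?_, a, c, ⟨h.left, ?_, h.prod_eq, h.length_eq⟩,
      fun u hu => hav u (by simp [hu])⟩
    · have := hJ hu
      have hne : u ≠ v := fun h => hvJ (h ▸ hu)
      simpa [hne] using this
    · rcases List.sublist_cons_iff.1 h.right with h' | ⟨c', rfl, -⟩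
      · exact h'
      · exact absurd (List.mem_cons_self) (hav v (by simp)).2
  · rintro ⟨hJ, a, c, h, hav⟩
    have hf : IsFactorization cs Q A m (v :: C) w a c :=
      ⟨h.left, h.right.cons v, h.prod_eq, h.length_eq⟩
    have hJ' : J ⊆ (A ++ v :: C).toFinset := fun u hu => by
      have := hJ hu
      simp only [List.mem_toFinset, List.mem_append, List.mem_cons] at this ⊢
      tauto
    refine ⟨⟨hJ', a, c, hf, hav⟩, ⟨?_, a, c, hf, ?_⟩, ?_⟩
    · rw [Finset.union_subset_iff]
      exact ⟨by simp, hJ'⟩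
    · intro u hu
      rw [Finset.mem_union, Finset.mem_singleton] at hu
      rcases hu with rfl | hu
      · simp only [List.mem_append, not_or] at hv
        exact ⟨fun h' => hv.1 (h.left.subset h'), fun h' => hv.2 (h.right.subset h')⟩
      · exact hav u hu
    · rw [Finset.disjoint_singleton_left]
      exact fun h' => hv (by simpa using hJ h')

lemma subset_toFinset_of_mem_deletion {J : Finset V}
    (hJ : J ∈ deletion (factorizationComplex cs Q A m (v :: C) w) {v}) :
    J ⊆ (A ++ C).toFinset := fun u hu => by
  have := hJ.1.1 hu
  have hne : u ≠ v := fun h => hJ.2 (by simpa using h ▸ hu)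
  simpa [hne] using this

lemma mem_deletion_of_isFactorization {J : Finset V} (hnd : (A ++ v :: C).Nodup)
    (hJ : J ⊆ (A ++ C).toFinset) {a c : List V} (h : IsFactorization cs Q A m (v :: C) w a c)
    (hav : ∀ u ∈ J, u ∉ a ∧ u ∉ c) :
    J ∈ deletion (factorizationComplex cs Q A m (v :: C) w) {v} := by
  have hv : v ∉ A ++ C := (List.nodup_middle.1 hnd).notMem
  refine ⟨⟨fun u hu => ?_, a, c, h, hav⟩, ?_⟩
  · have := hJ hu
    simp only [List.mem_toFinset, List.mem_append, List.mem_cons] at this ⊢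
    tauto
  · rw [Finset.singleton_subset_iff]
    exact fun h' => hv (by simpa using hJ h')

/-- A factorization using `v` would begin its right part with a descent of `m`, so it could not be
length-additive. -/
lemma deletion_factorizationComplex_of_descent (hnd : (A ++ v :: C).Nodup)
    (hm : cs.length (m * cs.simple (Q v)) < cs.length m) :
    deletion (factorizationComplex cs Q A m (v :: C) w) {v} =
      factorizationComplex cs Q A m C w := by
  ext J
  rw [SetLike.mem_coe, SetLike.mem_coe]
  constructor
  · intro hJ
    have hsub := subset_toFinset_of_mem_deletion hJ
    obtain ⟨⟨-, a, c, h, hav⟩, -⟩ := hJ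
    refine ⟨hsub, a, c, ⟨h.left, ?_, h.prod_eq, h.length_eq⟩, hav⟩
    rcases List.sublist_cons_iff.1 h.right with h' | ⟨c', rfl, -⟩
    · exact h'
    · exfalso
      have h0 := h.length_eq
      rw [← h.prod_eq, List.map_cons, cs.wordProd_cons, ← mul_assoc, mul_assoc _ m,
        List.length_cons] at h0
      have h1 := cs.length_mul_le (cs.wordProd (a.map Q) * (m * cs.simple (Q v)))
        (cs.wordProd (c'.map Q))
      have h2 := cs.length_mul_le (cs.wordProd (a.map Q)) (m * cs.simple (Q v))
      have h3 := cs.length_wordProd_le (a.map Q)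
      have h4 := cs.length_wordProd_le (c'.map Q)
      rw [List.length_map] at h3 h4
      omega
  · rintro ⟨hJ, a, c, h, hav⟩
    exact mem_deletion_of_isFactorization hnd hJ
      ⟨h.left, h.right.cons v, h.prod_eq, h.length_eq⟩ hav

/-- A factorization that uses `v` has it absorbed into `m`. One that avoids `v` is converted by
`exists_of_ascent`, which is where maximality enters. -/
lemma deletion_factorizationComplex_of_ascent (hnd : (A ++ v :: C).Nodup)
    (hm : cs.length m < cs.length (m * cs.simple (Q v)))
    (H : ∀ w' a c, IsFactorization cs Q A m (v :: C) w' a c → cs.length w' ≤ cs.length w) :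
    deletion (factorizationComplex cs Q A m (v :: C) w) {v} =
      factorizationComplex cs Q A (m * cs.simple (Q v)) C w := by
  have hv : v ∉ A ++ C := (List.nodup_middle.1 hnd).notMem
  ext J
  rw [SetLike.mem_coe, SetLike.mem_coe]
  constructor
  · intro hJ
    have hsub := subset_toFinset_of_mem_deletion hJ
    obtain ⟨⟨-, a, c, h, hav⟩, -⟩ := hJ
    refine ⟨hsub, ?_⟩
    rcases List.sublist_cons_iff.1 h.right with h' | ⟨c', rfl, h'⟩
    · obtain ⟨a', c', ha, hc, hf⟩ := IsFactorization.exists_of_ascent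
        ⟨h.left, h', h.prod_eq, h.length_eq⟩ hm H
      exact ⟨a', c', hf, fun u hu =>
        ⟨fun h => (hav u hu).1 (ha.subset h), fun h => (hav u hu).2 (hc.subset h)⟩⟩
    · refine ⟨a, c', ⟨h.left, h', ?_, ?_⟩,
      fun u hu => ⟨(hav u hu).1, fun h => (hav u hu).2 (by simp [h])⟩⟩
      · rw [← h.prod_eq, List.map_cons, cs.wordProd_cons]
        simp only [mul_assoc]
      · have h0 := h.length_eq
        rw [List.length_cons] at h0
        rcases cs.length_mul_simple m (Q v) with h | h <;> omega
  · rintro ⟨hJ, a, c, h, hav⟩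
    refine mem_deletion_of_isFactorization hnd hJ (IsFactorization.cons hm rfl h) fun u hu => ?_
    refine ⟨(hav u hu).1, ?_⟩
    rw [List.mem_cons, not_or]
    exact ⟨fun h' => hv (by simpa using hJ (h' ▸ hu)), (hav u hu).2⟩

end Cons

/-- Induction on `C`, always at the letter next to the middle element, with `m` left free because
deletion may change it. Maximality passes to links and deletions, since their factorizations come
from factorizations over the longer word. -/
lemma vertexDecomposable_of_nil (A : List V) (w : W)
    (hbase : ∀ m, (A ++ ([] : List V)).Nodup → ∅ ∈ factorizationComplex cs Q A m [] w →
      (∀ w' a c, IsFactorization cs Q A m [] w' a c → cs.length w' ≤ cs.length w) →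
      VertexDecomposable (factorizationComplex cs Q A m [] w)) (C : List V) :
    ∀ m, (A ++ C).Nodup → ∅ ∈ factorizationComplex cs Q A m C w →
      (∀ w' a c, IsFactorization cs Q A m C w' a c → cs.length w' ≤ cs.length w) →
      VertexDecomposable (factorizationComplex cs Q A m C w) := by
  induction C with
  | nil => exact hbase
  | cons v C ih =>
    intro m hnd hne H
    have hnd' : (A ++ C).Nodup := (List.nodup_cons.1 (List.nodup_middle.1 hnd)).2
    have hstay : ∅ ∈ factorizationComplex cs Q A m C w →
        VertexDecomposable (factorizationComplex cs Q A m C w) := fun h =>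
      ih m hnd' h fun w' a c hf =>
        H w' a c ⟨hf.left, hf.right.cons v, hf.prod_eq, hf.length_eq⟩
    have hdel : VertexDecomposable (deletion (factorizationComplex cs Q A m (v :: C) w) {v}) := by
      have h0 : ∅ ∈ deletion (factorizationComplex cs Q A m (v :: C) w) {v} := ⟨hne, by simp⟩
      rcases lt_or_gt_of_ne (cs.length_mul_simple_ne m (Q v)) with hm | hm
      · rw [deletion_factorizationComplex_of_descent hnd hm] at h0 ⊢
        exact hstay h0
      · rw [deletion_factorizationComplex_of_ascent hnd hm H] at h0 ⊢
        exact ih _ hnd' h0 fun w' a c hf => H w' a (v :: c) (IsFactorization.cons hm rfl hf)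
    by_cases hv : {v} ∈ factorizationComplex cs Q A m (v :: C) w
    · refine .of_vertex _ v (isPure_factorizationComplex hnd) hv hdel ?_
      have h0 : ∅ ∈ link (factorizationComplex cs Q A m (v :: C) w) {v} :=
        ⟨hne, by simpa using hv, by simp⟩
      rw [link_factorizationComplex hnd] at h0 ⊢
      exact hstay h0
    · rwa [deletion_eq_self hv] at hdel

theorem vertexDecomposable_factorizationComplex (hnd : (A ++ C).Nodup)
    (hne : ∅ ∈ factorizationComplex cs Q A m C w)
    (H : ∀ w' a c, IsFactorization cs Q A m C w' a c → cs.length w' ≤ cs.length w) :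
    VertexDecomposable (factorizationComplex cs Q A m C w) := by
  have hright : ∀ (w : W) (C : List V), ∀ m, (([] : List V) ++ C).Nodup →
      ∅ ∈ factorizationComplex cs Q [] m C w →
      (∀ w' a c, IsFactorization cs Q [] m C w' a c → cs.length w' ≤ cs.length w) →
      VertexDecomposable (factorizationComplex cs Q [] m C w) := fun w C => by
    refine vertexDecomposable_of_nil [] w (fun m _ hne _ => ?_) C
    have : factorizationComplex cs Q [] m [] w = simplex ∅ := by
      ext J
      exact ⟨fun h => Finset.subset_empty.2 (by simpa using h.1), fun h => by
        obtain rfl : J = ∅ := Finset.subset_empty.1 h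
        exact hne⟩
    rw [this]
    exact .of_simplex ∅
  refine vertexDecomposable_of_nil A w (fun m hnd hne H => ?_) C m hnd hne H
  -- With the right word exhausted, inversion turns `A` into the right word, and the same induction
  -- consumes it.
  rw [← factorizationComplex_reverse] at hne ⊢
  rw [List.reverse_nil] at hne ⊢
  refine hright w⁻¹ A.reverse m⁻¹ (by simpa using hnd) hne fun w' a c hf => ?_
  have := H w'⁻¹ c.reverse a.reverse (by simpa using hf.reverse)
  simpa using this

end SubwordComplex

/-! ### Absolute extensors and gluing. -/

section AbsoluteExtensor

variable {Y E : Type*} [MetricSpace Y] [TopologicalSpace E]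

/-- `X` is an absolute extensor for the closed subsets of `Y`. -/
def IsAbsExtensor (Y : Type*) {E : Type*} [MetricSpace Y] [TopologicalSpace E] (X : Set E) : Prop :=
  ∀ K : Set Y, IsClosed K → ∀ f : Y → E, ContinuousOn f K → Set.MapsTo f K X →
    ∃ g : Y → E, Continuous g ∧ (∀ y, g y ∈ X) ∧ Set.EqOn g f K

lemma exists_eqOn_of_isClosed {s t : Set Y} (hs : IsClosed s) (ht : IsClosed t) {f g : Y → E}
    (hf : ContinuousOn f s) (hg : ContinuousOn g t) (h : Set.EqOn f g (s ∩ t)) :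
    ∃ k : Y → E, ContinuousOn k (s ∪ t) ∧ Set.EqOn k f s ∧ Set.EqOn k g t := by
  classical
  have e1 : Set.EqOn (s.piecewise f g) f s := Set.piecewise_eqOn s f g
  have e2 : Set.EqOn (s.piecewise f g) g t := fun y hy => by
    by_cases hys : y ∈ s
    · rw [Set.piecewise_eq_of_mem _ _ _ hys, h ⟨hys, hy⟩]
    · rw [Set.piecewise_eq_of_notMem _ _ _ hys]
  exact ⟨s.piecewise f g, (hf.congr e1).union_of_isClosed (hg.congr e2) hs ht, e1, e2⟩

/-- The two sets consist of the points at least as close to `K` as to `L`, and conversely.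
Nonemptiness matters because `Metric.infDist` to the empty set is `0`. -/
lemma exists_isClosed_separation {K L : Set Y} (hK : IsClosed K) (hL : IsClosed L)
    (hKne : K.Nonempty) (hLne : L.Nonempty) :
    ∃ s t : Set Y, IsClosed s ∧ IsClosed t ∧ s ∪ t = Set.univ ∧ K ⊆ s ∧ L ⊆ t ∧
      s ∩ L ⊆ K ∧ t ∩ K ⊆ L := by
  refine ⟨{y | Metric.infDist y K ≤ Metric.infDist y L}, {y | Metric.infDist y L ≤
      Metric.infDist y K},
    isClosed_le (Metric.continuous_infDist_pt K) (Metric.continuous_infDist_pt L),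
    isClosed_le (Metric.continuous_infDist_pt L) (Metric.continuous_infDist_pt K),
    Set.eq_univ_of_forall fun y => le_total (Metric.infDist y K) (Metric.infDist y L),
        fun y hy => ?_, fun y hy => ?_, ?_, ?_⟩
  · simp [Metric.infDist_zero_of_mem hy, Metric.infDist_nonneg]
  · simp [Metric.infDist_zero_of_mem hy, Metric.infDist_nonneg]
  · rintro y ⟨h, hy⟩
    rw [Set.mem_ofPred_eq, Metric.infDist_zero_of_mem hy] at h
    exact (hK.mem_iff_infDist_zero hKne).2 (le_antisymm h Metric.infDist_nonneg)
  · rintro y ⟨h, hy⟩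
    rw [Set.mem_ofPred_eq, Metric.infDist_zero_of_mem hy] at h
    exact (hL.mem_iff_infDist_zero hLne).2 (le_antisymm h Metric.infDist_nonneg)

/-- The union of two closed absolute extensors which meet in an absolute extensor is an absolute
extensor. -/
theorem IsAbsExtensor.union {X Z : Set E} (hX : IsAbsExtensor Y X) (hZ : IsAbsExtensor Y Z)
    (hXZ : IsAbsExtensor Y (X ∩ Z : Set E)) (hXc : IsClosed X) (hZc : IsClosed Z) :
    IsAbsExtensor Y (X ∪ Z) := by
  intro K hK f hf hmaps
  have hKX : IsClosed (K ∩ f ⁻¹' X) := hf.preimage_isClosed_of_isClosed hK hXc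
  have hKZ : IsClosed (K ∩ f ⁻¹' Z) := hf.preimage_isClosed_of_isClosed hK hZc
  rcases (K ∩ f ⁻¹' X).eq_empty_or_nonempty with h1 | h1
  · obtain ⟨g, hg, hgm, hge⟩ := hZ K hK f hf fun y hy => (hmaps hy).resolve_left fun h =>
      (Set.eq_empty_iff_forall_notMem.1 h1 y) ⟨hy, h⟩
    exact ⟨g, hg, fun y => Or.inr (hgm y), hge⟩
  rcases (K ∩ f ⁻¹' Z).eq_empty_or_nonempty with h2 | h2
  · obtain ⟨g, hg, hgm, hge⟩ := hX K hK f hf fun y hy => (hmaps hy).resolve_right fun h =>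
      (Set.eq_empty_iff_forall_notMem.1 h2 y) ⟨hy, h⟩
    exact ⟨g, hg, fun y => Or.inl (hgm y), hge⟩
  obtain ⟨s, t, hs, ht, hst, hKs, hLt, hsL, htK⟩ := exists_isClosed_separation hKX hKZ h1 h2
  -- The interface `s ∩ t` is sent into `X ∩ Z` by `g`. Then `s` is filled inside `X` and `t` inside
  -- `Z`, and the two fillings agree on the interface.
  obtain ⟨g, hg, hgm, hge⟩ := hXZ ((K ∩ f ⁻¹' X) ∩ (K ∩ f ⁻¹' Z)) (hKX.inter hKZ) f
    (hf.mono fun y hy => hy.1.1) fun y hy => ⟨hy.1.2, hy.2.2⟩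
  obtain ⟨p, hp, hpf, hpg⟩ := exists_eqOn_of_isClosed hKX (hs.inter ht)
    (hf.mono Set.inter_subset_left) hg.continuousOn
    fun y hy => (hge ⟨hy.1, htK ⟨hy.2.2, hy.1⟩⟩).symm
  obtain ⟨q, hq, hqf, hqg⟩ := exists_eqOn_of_isClosed hKZ (hs.inter ht)
    (hf.mono Set.inter_subset_left) hg.continuousOn
    fun y hy => (hge ⟨hsL ⟨hy.2.1, hy.1⟩, hy.1⟩).symm
  obtain ⟨P, hP, hPm, hPe⟩ := hX _ (hKX.union (hs.inter ht)) p hp fun y hy => by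
    rcases hy with hy | hy
    · rw [hpf hy]; exact hy.2
    · rw [hpg hy]; exact (hgm y).1
  obtain ⟨R, hR, hRm, hRe⟩ := hZ _ (hKZ.union (hs.inter ht)) q hq fun y hy => by
    rcases hy with hy | hy
    · rw [hqf hy]; exact hy.2
    · rw [hqg hy]; exact (hgm y).2
  obtain ⟨k, hk, hkP, hkR⟩ := exists_eqOn_of_isClosed hs ht hP.continuousOn hR.continuousOn
    fun y hy => by rw [hPe (Or.inr hy), hRe (Or.inr hy), hpg hy, hqg hy]
  rw [hst, continuousOn_univ] at hk
  refine ⟨k, hk, fun y => ?_, fun y hy => ?_⟩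
  · have hy : y ∈ s ∪ t := hst ▸ Set.mem_univ y
    rcases hy with hy | hy
    · rw [hkP hy]; exact Or.inl (hPm y)
    · rw [hkR hy]; exact Or.inr (hRm y)
  · rcases hmaps hy with h | h
    · have hy' : y ∈ K ∩ f ⁻¹' X := ⟨hy, h⟩
      rw [hkP (hKs hy'), hPe (Or.inl hy'), hpf hy']
    · have hy' : y ∈ K ∩ f ⁻¹' Z := ⟨hy, h⟩
      rw [hkR (hLt hy'), hRe (Or.inl hy'), hqf hy']

/-- A retract of `ℝ^V` is an absolute extensor. -/
lemma IsAbsExtensor.of_retraction {V : Type*} {X : Set (V → ℝ)} {ρ : (V → ℝ) → V → ℝ}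
    (hρ : Continuous ρ) (hm : ∀ x, ρ x ∈ X) (hid : ∀ x ∈ X, ρ x = x) : IsAbsExtensor Y X := by
  intro K hK f hf hmaps
  obtain ⟨g, hg⟩ := ContinuousMap.exists_restrict_eq hK ⟨K.domRestrict f, hf.domRestrict⟩
  refine ⟨fun y => ρ (g y), hρ.comp g.continuous, fun y => hm _, fun y hy => ?_⟩
  have : g y = f y := congrArg (fun k : C(K, V → ℝ) => k ⟨y, hy⟩) hg
  simp only [this]
  exact hid _ (hmaps hy)

end AbsoluteExtensor

/-! ### Barycentric coordinates; cones are absolute extensors. -/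

namespace SimpComplex

variable {V : Type*}

section

variable [DecidableEq V]

lemma simplex_inf_simplex (F G : Finset V) : simplex F ⊓ simplex G = simplex (F ∩ G) := by
  ext J
  exact Finset.subset_inter_iff.symm

end

variable [Fintype V]

/-- The points with barycentric coordinates supported on a face. -/
def barycentric (Δ : LowerSet (Finset V)) : Set (V → ℝ) :=
  {x | (∀ i, 0 ≤ x i) ∧ ∑ i, x i = 1 ∧ Finset.univ.filter (fun i => x i ≠ 0) ∈ Δ}

lemma barycentric_sup (Δ Γ : LowerSet (Finset V)) :
    barycentric (Δ ⊔ Γ) = barycentric Δ ∪ barycentric Γ := by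
  ext x
  simp only [barycentric, Set.mem_ofPred_eq, LowerSet.mem_sup_iff, Set.mem_union]
  tauto

lemma barycentric_inf (Δ Γ : LowerSet (Finset V)) :
    barycentric (Δ ⊓ Γ) = barycentric Δ ∩ barycentric Γ := by
  ext x
  simp only [barycentric, Set.mem_ofPred_eq, LowerSet.mem_inf_iff, Set.mem_inter_iff]
  tauto

variable [DecidableEq V]

lemma barycentric_simplex (F : Finset V) : barycentric (simplex F) =
    convexHull ℝ ((fun i : V => (Pi.single i 1 : V → ℝ)) '' (F : Set V)) := by
  apply Set.Subset.antisymm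
  · rintro x ⟨h0, h1, hF⟩
    have hF' : ∀ i, i ∉ F → x i = 0 := fun i hi => by
      by_contra h
      exact hi (hF (by simpa using h))
    have hsum : ∑ i ∈ F, x i = 1 := by
      rw [← h1]
      exact Finset.sum_subset (Finset.subset_univ _) fun i _ hi => hF' i hi
    have hx : x = ∑ i ∈ F, x i • (Pi.single i 1 : V → ℝ) := by
      ext j
      simp only [Finset.sum_apply, Pi.smul_apply, Pi.single_apply, smul_eq_mul, mul_ite, mul_one,
        mul_zero, Finset.sum_ite_eq]
      split_ifs with hj
      · rfl
      · exact hF' j hj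
    rw [hx]
    exact (convex_convexHull ℝ _).sum_mem (fun i _ => h0 i) hsum fun i hi =>
      subset_convexHull ℝ _ ⟨i, hi, rfl⟩
  · apply convexHull_min
    · rintro _ ⟨i, hi, rfl⟩
      refine ⟨fun j => ?_, by simp, fun j hj => ?_⟩
      · by_cases h : j = i
        · subst h; simp
        · simp [h]
      · by_cases h : j = i
        · subst h; exact hi
        · simp [h] at hj
    · rintro x ⟨hx0, hx1, hxF⟩ y ⟨hy0, hy1, hyF⟩ a b ha hb hab
      refine ⟨fun i => ?_, ?_, fun i hi => ?_⟩
      · have := hx0 i; have := hy0 i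
        simp only [Pi.add_apply, Pi.smul_apply, smul_eq_mul]
        positivity
      · simp only [Pi.add_apply, Pi.smul_apply, smul_eq_mul, Finset.sum_add_distrib,
          ← Finset.mul_sum, hx1, hy1, mul_one, hab]
      · by_contra h
        have h1 : x i = 0 := by
          by_contra h'; exact h (hxF (by simpa using h'))
        have h2 : y i = 0 := by
          by_contra h'; exact h (hyF (by simpa using h'))
        simp [h1, h2] at hi

lemma realization_eq_barycentric (Δ : LowerSet (Finset V)) : realization Δ = barycentric Δ := by
  ext x
  simp only [realization, Set.mem_iUnion, ← barycentric_simplex]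
  constructor
  · rintro ⟨I, hI, h0, h1, hx⟩
    exact ⟨h0, h1, Δ.lower hx hI⟩
  · rintro ⟨h0, h1, hx⟩
    exact ⟨_, hx, h0, h1, Finset.Subset.refl _⟩

lemma isClosed_barycentric (Δ : LowerSet (Finset V)) : IsClosed (barycentric Δ) := by
  rw [← realization_eq_barycentric]
  refine (Set.toFinite (Δ : Set (Finset V))).isClosed_biUnion fun I _ => ?_
  exact ((Set.toFinite _).isCompact_convexHull (𝕜 := ℝ)).isClosed

variable {Y : Type*} [MetricSpace Y]

lemma isAbsExtensor_simplex {F : Finset V} {v : V} (hv : v ∈ F) :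
    IsAbsExtensor Y (barycentric (simplex F)) := by
  -- The retraction truncates the coordinates in `F` other than `v` at zero, scales them down to
  -- total mass at most one, and gives the missing mass to `v`.
  set σ : (V → ℝ) → ℝ := fun x => ∑ j ∈ F.erase v, max (x j) 0 with hσ
  set τ : (V → ℝ) → V → ℝ := fun x i => if i ∈ F.erase v then max (x i) 0 / max 1 (σ x) else 0
    with hτ
  have hpos : ∀ x, 0 < max 1 (σ x) := fun x => lt_max_of_lt_left one_pos
  have hσ0 : ∀ x, 0 ≤ σ x := fun x => Finset.sum_nonneg fun j _ => le_max_right _ _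
  have hsum : ∀ x, ∑ i, τ x i = σ x / max 1 (σ x) := fun x => by
    simp only [hτ, hσ, ← Finset.sum_filter, Finset.sum_div]
    congr 1
    ext; simp
  have hτv : ∀ x, τ x v = 0 := fun x => by simp [hτ]
  have hτ0 : ∀ x i, 0 ≤ τ x i := fun x i => by
    simp only [hτ]
    split_ifs
    · exact div_nonneg (le_max_right _ _) (hpos x).le
    · rfl
  have hle : ∀ x, ∑ i, τ x i ≤ 1 := fun x => by
    rw [hsum, div_le_one (hpos x)]
    exact le_max_right _ _
  have hσc : Continuous σ := by fun_prop
  have hτc : Continuous τ := by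
    refine continuous_pi fun i => ?_
    by_cases hi : i ∈ F.erase v
    · simp only [hτ, hi, if_true]
      exact Continuous.div (by fun_prop) (by fun_prop) fun x => (hpos x).ne'
    · simp only [hτ, hi, if_false]
      exact continuous_const
  refine IsAbsExtensor.of_retraction (ρ := fun x => τ x + (1 - ∑ i, τ x i) • Pi.single v 1)
    (by fun_prop) (fun x => ⟨fun i => ?_, ?_, fun i hi => ?_⟩) fun x hx => ?_
  · have := hτ0 x i
    have h1 : 0 ≤ 1 - ∑ i, τ x i := sub_nonneg.2 (hle x)
    by_cases h : i = v
    · subst h; simp only [Pi.add_apply, Pi.smul_apply, Pi.single_eq_same, smul_eq_mul]; linarith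
    · simpa [h] using this
  · simp [Finset.sum_add_distrib, ← Finset.mul_sum]
  · by_contra h
    have h1 : i ≠ v := fun h' => h (h' ▸ hv)
    have h2 : i ∉ F.erase v := fun h' => h (Finset.mem_of_mem_erase h')
    simp [h1, hτ, h] at hi
  · obtain ⟨h0, h1, hF⟩ := hx
    have hF' : ∀ i, i ∉ F → x i = 0 := fun i hi => by
      by_contra h
      exact hi (hF (by simpa using h))
    have hsumF : ∑ i ∈ F, x i = 1 := by
      rw [← h1]
      exact Finset.sum_subset (Finset.subset_univ _) fun i _ hi => hF' i hi
    have hσx : σ x = 1 - x v := by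
      rw [← hsumF, ← Finset.add_sum_erase _ _ hv, add_sub_cancel_left]
      exact Finset.sum_congr rfl fun j _ => max_eq_left (h0 j)
    have hmax : max 1 (σ x) = 1 := max_eq_left (by rw [hσx]; linarith [h0 v])
    ext i
    simp only [Pi.add_apply, Pi.smul_apply, smul_eq_mul, hsum, hσx]
    by_cases h : i = v
    · subst h
      rw [hσx] at hmax
      simp [hτ, hmax]
    · by_cases hi : i ∈ F
      · simp [hτ, h, hi, hmax, max_eq_left (h0 i)]
      · simp [hτ, h, hi, hF' i hi]

/-- One simplex meets the union of the others in a union of fewer simplices, all still containing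
`v`. Induction on their number therefore covers the intersection needed for gluing. -/
lemma isAbsExtensor_sup_simplex {α : Type*} {v : V} (n : ℕ) : ∀ (ι : Finset α) (F : α → Finset V),
    ι.card = n + 1 → (∀ i ∈ ι, v ∈ F i) →
        IsAbsExtensor Y (barycentric (ι.sup fun i => simplex (F i))) := by
  classical
  induction n with
  | zero =>
    intro ι F hι hF
    obtain ⟨i, rfl⟩ := Finset.card_eq_one.1 hι
    rw [Finset.sup_singleton]
    exact isAbsExtensor_simplex (hF i (by simp))
  | succ n ih =>
    intro ι F hι hF
    obtain ⟨i, κ, hi, rfl, hκ⟩ := Finset.card_eq_succ.1 hι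
    rw [Finset.sup_insert, barycentric_sup]
    have hFi := hF i (by simp)
    have hFκ : ∀ j ∈ κ, v ∈ F j := fun j hj => hF j (by simp [hj])
    refine (isAbsExtensor_simplex hFi).union (ih κ F hκ hFκ) ?_ (isClosed_barycentric _)
      (isClosed_barycentric _)
    rw [← barycentric_inf, Finset.sup_inf_distrib_left]
    simp only [simplex_inf_simplex]
    exact ih κ (fun j => F i ∩ F j) hκ fun j hj => Finset.mem_inter.2 ⟨hFi, hFκ j hj⟩

/-- A cone with apex `v` is an absolute extensor. -/
theorem isAbsExtensor_cone {Δ : LowerSet (Finset V)} {v : V} (hv : {v} ∈ Δ)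
    (hcone : ∀ J ∈ Δ, insert v J ∈ Δ) : IsAbsExtensor Y (barycentric Δ) := by
  classical
  set 𝓕 : Finset (Finset V) := Finset.univ.filter fun F => F ∈ Δ ∧ v ∈ F with h𝓕
  have hΔ : Δ = 𝓕.sup simplex := by
    apply le_antisymm
    · intro J hJ
      have h : simplex (insert v J) ≤ 𝓕.sup simplex := Finset.le_sup (f := simplex)
        (Finset.mem_filter.2 ⟨Finset.mem_univ _, hcone J hJ, Finset.mem_insert_self v J⟩)
      exact h (Finset.subset_insert v J)
    · exact Finset.sup_le fun F hF J hJ => Δ.lower hJ (Finset.mem_filter.1 hF).2.1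
  have hne : 0 < 𝓕.card := Finset.card_pos.2 ⟨{v}, by simp [h𝓕, hv]⟩
  rw [hΔ]
  exact isAbsExtensor_sup_simplex (v := v) (𝓕.card - 1) 𝓕 id (by omega)
    fun F hF => (Finset.mem_filter.1 hF).2.2

end SimpComplex

/-! ### Demazure products and subword complexes of non-maximal elements. -/

namespace SubwordComplex

open SimpComplex

variable {B W V : Type*} [Group W] {M : CoxeterMatrix B} (cs : CoxeterSystem M W) (Q : V → B)

/-- `c` is a subword of `L` whose letters form a reduced expression of `w`. -/
structure IsReducedSubword (L : List V) (w : W) (c : List V) : Prop where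
  sublist : c.Sublist L
  prod_eq : cs.wordProd (c.map Q) = w
  length_eq : c.length = cs.length w

variable {cs Q} {L c : List V} {w : W} {v : V}

lemma isFactorization_nil_one_iff {a : List V} :
    IsFactorization cs Q [] 1 L w a c ↔ a = [] ∧ IsReducedSubword cs Q L w c := by
  constructor
  · rintro ⟨h1, h2, h3, h4⟩
    obtain rfl := List.sublist_nil.1 h1
    exact ⟨rfl, h2, by simpa using h3, by simpa using h4⟩
  · rintro ⟨rfl, h2, h3, h4⟩
    exact ⟨.refl _, h2, by simpa using h3, by simpa using h4⟩

lemma IsReducedSubword.cons (h : IsReducedSubword cs Q L w c) :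
    IsReducedSubword cs Q (v :: L) w c := ⟨h.sublist.cons v, h.prod_eq, h.length_eq⟩

lemma IsReducedSubword.cons_cons (h : IsReducedSubword cs Q L w c)
    (hw : cs.length w < cs.length (cs.simple (Q v) * w)) :
    IsReducedSubword cs Q (v :: L) (cs.simple (Q v) * w) (v :: c) := by
  refine ⟨h.sublist.cons_cons v, by rw [List.map_cons, cs.wordProd_cons, h.prod_eq], ?_⟩
  rcases cs.length_simple_mul w (Q v) with h' | h' <;> rw [List.length_cons, h.length_eq] <;> omega

lemma IsReducedSubword.of_cons (h : IsReducedSubword cs Q (v :: L) w c) :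
    IsReducedSubword cs Q L w c ∨ cs.length (cs.simple (Q v) * w) < cs.length w ∧
      ∃ c', c = v :: c' ∧ IsReducedSubword cs Q L (cs.simple (Q v) * w) c' := by
  rcases List.sublist_cons_iff.1 h.sublist with h' | ⟨c', rfl, h'⟩
  · exact Or.inl ⟨h', h.prod_eq, h.length_eq⟩
  · right
    have h1 : cs.wordProd (c'.map Q) = cs.simple (Q v) * w := by
      rw [← h.prod_eq, List.map_cons, cs.wordProd_cons]
      simp
    have h2 := cs.length_wordProd_le (c'.map Q)
    have h3 := h.length_eq
    rw [h1, List.length_map] at h2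
    rw [List.length_cons] at h3
    refine ⟨by omega, c', rfl, h', h1, ?_⟩
    rcases cs.length_simple_mul w (Q v) with h | h <;> omega

lemma IsReducedSubword.exists_of_descent (h : IsReducedSubword cs Q L w c) {i : B}
    (hw : cs.length (cs.simple i * w) < cs.length w) :
    ∃ c', c'.Sublist c ∧ IsReducedSubword cs Q L (cs.simple i * w) c' := by
  obtain ⟨j, hj, he⟩ := cs.exists_eraseIdx_of_isLeftDescent (ω := c.map Q) (i := i)
    (by rw [h.prod_eq]; exact hw)
  rw [List.length_map] at hj
  rw [h.prod_eq] at he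
  refine ⟨c.eraseIdx j, List.eraseIdx_sublist _ _, (List.eraseIdx_sublist _ _).trans h.sublist,
    by rw [he, List.eraseIdx_map], ?_⟩
  have := h.length_eq
  rw [List.length_eraseIdx_of_lt hj]
  rcases cs.length_simple_mul w i with h | h <;> omega

variable (cs Q) in
/-- The Demazure product: among the elements with a reduced expression that is a subword of `L`
there is a largest one in the Bruhat order. -/
theorem exists_demazure_product (L : List V) : ∃ δ, (∃ c, IsReducedSubword cs Q L δ c) ∧
    ∀ w c, IsReducedSubword cs Q L w c → cs.BruhatLE w δ := by
  induction L with
  | nil =>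
    refine ⟨1, ⟨[], .refl _, by simp, by simp⟩, fun w c h => ?_⟩
    obtain rfl := List.sublist_nil.1 h.sublist
    have := h.prod_eq
    simp only [List.map_nil, CoxeterSystem.wordProd_nil] at this
    rw [this]
    exact .refl
  | cons v L ih =>
    obtain ⟨δ, ⟨d, hd⟩, hmax⟩ := ih
    -- The new maximum is the larger of `δ` and `s δ`. The lifting property bounds every `s x` with
    -- `x ≤ δ`.
    rcases lt_or_gt_of_ne (cs.length_simple_mul_ne δ (Q v)) with hδ | hδ
    · refine ⟨δ, ⟨d, hd.cons⟩, fun w c h => ?_⟩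
      have hle := cs.bruhatLE_simple_mul (x := cs.simple (Q v) * δ) (i := Q v) (by simpa using hδ)
      rw [cs.simple_mul_simple_cancel_left] at hle
      rcases h.of_cons with h | ⟨-, c', -, h⟩
      · exact hmax w c h
      · have := (hmax _ c' h).simple_mul cs (Q v)
        rw [cs.simple_mul_simple_cancel_left] at this
        exact this.elim id fun h => h.trans hle
    · refine ⟨cs.simple (Q v) * δ, ⟨v :: d, hd.cons_cons hδ⟩, fun w c h => ?_⟩
      have hle := cs.bruhatLE_simple_mul hδ
      rcases h.of_cons with h | ⟨-, c', -, h⟩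
      · exact (hmax w c h).trans hle
      · have := (hmax _ c' h).simple_mul cs (Q v)
        rw [cs.simple_mul_simple_cancel_left] at this
        exact this.elim (fun h => h.trans hle) id

/-- Both elements lie below the Demazure product. If it had their common length, both would equal
it. -/
lemma IsReducedSubword.exists_longer {w' : W} {c' : List V} (h : IsReducedSubword cs Q L w c)
    (h' : IsReducedSubword cs Q L w' c') (hlen : cs.length w = cs.length w') (hne : w ≠ w') :
    ∃ u d, IsReducedSubword cs Q L u d ∧ cs.length w < cs.length u := by
  obtain ⟨δ, ⟨d, hd⟩, hmax⟩ := exists_demazure_product cs Q L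
  refine ⟨δ, d, hd, ?_⟩
  rcases (hmax w c h).eq_or_length_lt with rfl | h1
  · rcases (hmax w' c' h').eq_or_length_lt with rfl | h2
    · exact absurd rfl hne
    · exact absurd hlen h2.ne'
  · exact h1

variable [DecidableEq V]

lemma mem_factorizationComplex_nil_one {J : Finset V} :
    J ∈ factorizationComplex cs Q [] 1 L w ↔
      J ⊆ L.toFinset ∧ ∃ c, IsReducedSubword cs Q L w c ∧ ∀ v ∈ J, v ∉ c := by
  rw [mem_factorizationComplex, List.nil_append]
  refine and_congr_right fun _ => ⟨?_, ?_⟩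
  · rintro ⟨a, c, h, hav⟩
    exact ⟨c, (isFactorization_nil_one_iff.1 h).2, fun v hv => (hav v hv).2⟩
  · rintro ⟨c, h, hav⟩
    exact ⟨[], c, isFactorization_nil_one_iff.2 ⟨rfl, h⟩, fun v hv => ⟨by simp, hav v hv⟩⟩

/-- The cone with apex `v` over a complex. -/
def star (v : V) (Δ : LowerSet (Finset V)) : LowerSet (Finset V) where
  carrier := {J | J.erase v ∈ Δ}
  lower' := fun _ _ hba hJ => Δ.lower (Finset.erase_subset_erase v hba) hJ

lemma mem_star {Δ : LowerSet (Finset V)} {J : Finset V} : J ∈ star v Δ ↔ J.erase v ∈ Δ := Iff.rfl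

lemma isAbsExtensor_star [Fintype V] {Y : Type*} [MetricSpace Y] {Δ : LowerSet (Finset V)}
    (hΔ : ∅ ∈ Δ) : IsAbsExtensor Y (barycentric (star v Δ)) := by
  refine isAbsExtensor_cone (v := v) ?_ fun J hJ => ?_
  · rwa [mem_star, Finset.erase_singleton]
  · rw [mem_star] at hJ ⊢
    rwa [Finset.erase_insert_eq_erase]

lemma mem_star_factorizationComplex {J : Finset V} (hv : v ∉ L) :
    J ∈ star v (factorizationComplex cs Q [] 1 L w) ↔
      J ⊆ (v :: L).toFinset ∧ ∃ c, IsReducedSubword cs Q L w c ∧ ∀ v ∈ J, v ∉ c := by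
  rw [mem_star, mem_factorizationComplex_nil_one, List.toFinset_cons, Finset.subset_insert_iff]
  refine and_congr_right fun _ => exists_congr fun c => and_congr_right fun hc => ?_
  refine ⟨fun h u hu => ?_, fun h u hu => h u (Finset.mem_of_mem_erase hu)⟩
  by_cases huv : u = v
  · exact huv ▸ fun h' => hv (hc.sublist.subset h')
  · exact h u (Finset.mem_erase.2 ⟨huv, hu⟩)

lemma empty_mem_factorizationComplex_nil_one (h : ∃ c, IsReducedSubword cs Q L w c) :
    ∅ ∈ factorizationComplex cs Q [] 1 L w :=
  mem_factorizationComplex_nil_one.2 ⟨by simp, h.imp fun c hc => ⟨hc, by simp⟩⟩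

lemma factorizationComplex_cons_of_ascent (hv : v ∉ L)
    (hw : cs.length w < cs.length (cs.simple (Q v) * w)) :
    factorizationComplex cs Q [] 1 (v :: L) w = star v (factorizationComplex cs Q [] 1 L w) := by
  ext J
  rw [SetLike.mem_coe, SetLike.mem_coe, mem_star_factorizationComplex hv,
    mem_factorizationComplex_nil_one]
  refine and_congr_right fun _ => exists_congr fun c => and_congr_left fun _ => ⟨fun h => ?_, .cons⟩
  exact h.of_cons.resolve_right fun h' => by omega

/-- Exchange drops a letter from a subword for `w` to produce one for `s w`. This makes the two
pieces of the later union meet exactly in the complex of `w`. -/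
lemma factorizationComplex_le_of_descent
    (hw : cs.length (cs.simple (Q v) * w) < cs.length w) :
    factorizationComplex cs Q [] 1 L w ≤ factorizationComplex cs Q [] 1 L (cs.simple (Q v) * w) :=
        by
  intro J hJ
  obtain ⟨hJ, c, hc, hav⟩ := mem_factorizationComplex_nil_one.1 hJ
  obtain ⟨c', hcc', hc'⟩ := hc.exists_of_descent hw
  exact mem_factorizationComplex_nil_one.2 ⟨hJ, c', hc', fun u hu h => hav u hu (hcc'.subset h)⟩

lemma factorizationComplex_le_cons_of_descent (hv : v ∉ L)
    (hw : cs.length (cs.simple (Q v) * w) < cs.length w) :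
    factorizationComplex cs Q [] 1 L (cs.simple (Q v) * w) ≤
      factorizationComplex cs Q [] 1 (v :: L) w := by
  intro J hJ
  obtain ⟨hJ, c, hc, hav⟩ := mem_factorizationComplex_nil_one.1 hJ
  have h := hc.cons_cons (v := v) (by simpa using hw)
  rw [cs.simple_mul_simple_cancel_left] at h
  refine mem_factorizationComplex_nil_one.2 ⟨fun u hu => ?_, v :: c, h, fun u hu => ?_⟩
  · have := hJ hu
    simp only [List.mem_toFinset, List.mem_cons] at this ⊢
    exact Or.inr this
  · rw [List.mem_cons, not_or]
    exact ⟨fun h' => hv (by simpa using hJ (h' ▸ hu)), hav u hu⟩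

lemma mem_of_mem_factorizationComplex_cons {J : Finset V} (hv : v ∉ L)
    (hJ : J ∈ factorizationComplex cs Q [] 1 (v :: L) w) :
    J ∈ factorizationComplex cs Q [] 1 L (cs.simple (Q v) * w) ∨
      J ∈ star v (factorizationComplex cs Q [] 1 L w) := by
  rw [mem_star_factorizationComplex hv]
  obtain ⟨hJ, c, hc, hav⟩ := mem_factorizationComplex_nil_one.1 hJ
  rcases hc.of_cons with h' | ⟨-, c', rfl, h'⟩
  · exact Or.inr ⟨hJ, c, h', hav⟩
  · refine Or.inl (mem_factorizationComplex_nil_one.2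
      ⟨fun u hu => ?_, c', h', fun u hu h => hav u hu (by simp [h])⟩)
    have h1 := hJ hu
    have h2 := hav u hu
    simp only [List.mem_toFinset, List.mem_cons, not_or] at h1 h2 ⊢
    exact h1.resolve_left h2.1

/-- If some reduced subword of `L` is longer than the reduced expressions of `w`, then the
realization of the complex of `w` is an absolute extensor. -/
theorem isAbsExtensor_factorizationComplex [Fintype V] {Y : Type*} [MetricSpace Y] (L : List V) :
    ∀ w, L.Nodup → (∃ c, IsReducedSubword cs Q L w c) →
      (∃ w' c, IsReducedSubword cs Q L w' c ∧ cs.length w < cs.length w') →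
      IsAbsExtensor Y (barycentric (factorizationComplex cs Q [] 1 L w)) := by
  induction L with
  | nil =>
    rintro w - - ⟨w', c, h, hlt⟩
    have := h.length_eq
    rw [List.sublist_nil.1 h.sublist, List.length_nil] at this
    omega
  | cons v L ih =>
    rintro w hnd ⟨c, hc⟩ ⟨w', c', hc', hlt⟩
    have hnd' := (List.nodup_cons.1 hnd).2
    have hv := (List.nodup_cons.1 hnd).1
    rcases lt_or_gt_of_ne (cs.length_simple_mul_ne w (Q v)) with hw | hw
    · have hw1 : cs.length (cs.simple (Q v) * w) + 1 = cs.length w := by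
        rcases cs.length_simple_mul w (Q v) with h | h <;> omega
      have hw'1 := cs.length_simple_mul w' (Q v)
      have hD : IsAbsExtensor Y
          (barycentric (factorizationComplex cs Q [] 1 L (cs.simple (Q v) * w))) := by
        refine ih _ hnd' ?_ ?_
        · rcases hc.of_cons with h | ⟨-, d, -, h⟩
          · obtain ⟨d, -, hd⟩ := h.exists_of_descent hw
            exact ⟨d, hd⟩
          · exact ⟨d, h⟩
        · rcases hc'.of_cons with h | ⟨-, d, -, h⟩
          · exact ⟨w', c', h, by omega⟩
          · exact ⟨_, d, h, by omega⟩
      -- If `w` needs the letter `v`, there is no cone piece and the complex is that of `s w` in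
      -- `L`.
      by_cases hrep : ∃ d, IsReducedSubword cs Q L w d
      · have hK : IsAbsExtensor Y (barycentric (factorizationComplex cs Q [] 1 L w)) := by
          refine ih w hnd' hrep ?_
          rcases hc'.of_cons with h | ⟨-, d, -, h⟩
          · exact ⟨w', c', h, hlt⟩
          · by_cases hlt' : cs.length w < cs.length (cs.simple (Q v) * w')
            · exact ⟨_, d, h, hlt'⟩
            · obtain ⟨e, he⟩ := hrep
              -- Here `s w'` has the length of `w`. If they were equal, `s w = w'` would be longer
              -- than `w`, contrary to the descent.
              obtain ⟨u, f, hf, hu⟩ := he.exists_longer h (by omega) fun h' => by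
                rw [h', cs.simple_mul_simple_cancel_left, ← h'] at hw
                omega
              exact ⟨u, f, hf, hu⟩
        have hsup : factorizationComplex cs Q [] 1 (v :: L) w =
            factorizationComplex cs Q [] 1 L (cs.simple (Q v) * w) ⊔
              star v (factorizationComplex cs Q [] 1 L w) := by
          apply le_antisymm
          · exact fun J hJ => mem_of_mem_factorizationComplex_cons hv hJ
          · refine sup_le (factorizationComplex_le_cons_of_descent hv hw) fun J hJ => ?_
            obtain ⟨hJ, d, hd, hav⟩ := (mem_star_factorizationComplex hv).1 hJ
            exact mem_factorizationComplex_nil_one.2 ⟨hJ, d, hd.cons, hav⟩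
        have hinf : factorizationComplex cs Q [] 1 L (cs.simple (Q v) * w) ⊓
            star v (factorizationComplex cs Q [] 1 L w) = factorizationComplex cs Q [] 1 L w := by
          apply le_antisymm
          · rintro J ⟨hJ, hJ'⟩
            obtain ⟨hJ, -⟩ := mem_factorizationComplex_nil_one.1 hJ
            have hvJ : v ∉ J := fun h => hv (by simpa using hJ h)
            rwa [SetLike.mem_coe, mem_star, Finset.erase_eq_of_notMem hvJ] at hJ'
          · refine le_inf (factorizationComplex_le_of_descent hw) fun J hJ => ?_
            exact (factorizationComplex cs Q [] 1 L w).lower (Finset.erase_subset v J) hJ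
        rw [hsup, barycentric_sup]
        refine hD.union (isAbsExtensor_star (empty_mem_factorizationComplex_nil_one hrep)) ?_
          (isClosed_barycentric _) (isClosed_barycentric _)
        rwa [← barycentric_inf, hinf]
      · have heq : factorizationComplex cs Q [] 1 (v :: L) w =
            factorizationComplex cs Q [] 1 L (cs.simple (Q v) * w) := by
          apply le_antisymm
          · intro J hJ
            refine (mem_of_mem_factorizationComplex_cons hv hJ).resolve_right fun h => hrep ?_
            obtain ⟨-, d, hd, -⟩ := (mem_star_factorizationComplex hv).1 h
            exact ⟨d, hd⟩
          · exact factorizationComplex_le_cons_of_descent hv hw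
        rwa [heq]
    · rw [factorizationComplex_cons_of_ascent hv hw]
      refine isAbsExtensor_star (empty_mem_factorizationComplex_nil_one ⟨c, ?_⟩)
      exact hc.of_cons.resolve_right fun h' => by omega

end SubwordComplex

/-! ### No retraction onto the sphere, by an analytic volume argument. -/

section NoRetraction

open MeasureTheory Metric

lemma exists_interpolation_weights {s : Finset ℕ} {v : ℕ → ℝ} (hv : Set.InjOn v s) :
    ∃ c : ℕ → ℝ, ∀ p : Polynomial ℝ, p.degree < s.card →
      p.eval 1 = ∑ j ∈ s, c j * p.eval (v j) := by
  refine ⟨fun j => (Lagrange.basis s v j).eval 1, fun p hp => ?_⟩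
  conv_lhs => rw [Lagrange.eq_interpolate_of_eval_eq (fun j => p.eval (v j)) hv hp fun _ _ => rfl]
  simp [Lagrange.interpolate_apply, Polynomial.eval_finsetSum, mul_comm]

variable {E : Type*} [NormedAddCommGroup E] [InnerProductSpace ℝ E]

/-- A segment leaving the ball crosses the unit sphere, where `φ` vanishes, so the bound inside
suffices. -/
lemma lipschitzWith_of_eq_zero {φ : E → E} {K : NNReal} (hφ : LipschitzOnWith K φ (closedBall 0 1))
    (h0 : ∀ x, 1 ≤ ‖x‖ → φ x = 0) : LipschitzWith K φ := by
  have key : ∀ x y, ‖x‖ ≤ 1 → 1 ≤ ‖y‖ → dist (φ x) (φ y) ≤ K * dist x y := by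
    intro x y hx hy
    have hc : ContinuousOn (fun s : ℝ => ‖AffineMap.lineMap x y s‖) (Set.Icc 0 1) := by
      have : Continuous fun s : ℝ => AffineMap.lineMap x y s := AffineMap.lineMap_continuous
      exact this.norm.continuousOn
    obtain ⟨s, hs, hs1⟩ := intermediate_value_Icc zero_le_one hc
      (show (1 : ℝ) ∈ Set.Icc _ _ by simpa using ⟨hx, hy⟩)
    set z : E := AffineMap.lineMap x y s with hz
    have hz1 : ‖z‖ = 1 := hs1
    have h1 := hφ.dist_le_mul x (by simpa using hx) z (by simp [hz1])
    rw [h0 z hz1.ge] at h1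
    rw [h0 y hy]
    refine h1.trans ?_
    gcongr
    rw [hz, dist_left_lineMap, Real.norm_of_nonneg hs.1]
    exact mul_le_of_le_one_left dist_nonneg hs.2
  refine LipschitzWith.of_dist_le_mul fun x y => ?_
  rcases le_total ‖x‖ 1 with hx | hx <;> rcases le_total ‖y‖ 1 with hy | hy
  · exact hφ.dist_le_mul x (by simpa using hx) y (by simpa using hy)
  · exact key x y hx hy
  · rw [dist_comm, dist_comm x]; exact key y x hy hx
  · rw [h0 x hx, h0 y hy, dist_self]; positivity

variable [FiniteDimensional ℝ E]

lemma exists_polynomial_det (A : E →L[ℝ] E) :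
    ∃ p : Polynomial ℝ, p.natDegree ≤ Module.finrank ℝ E ∧
      ∀ t : ℝ, p.eval t = (ContinuousLinearMap.id ℝ E + t • A).det := by
  set b := Module.finBasis ℝ E
  set N := LinearMap.toMatrix b b (A : E →ₗ[ℝ] E) with hN
  refine ⟨((Polynomial.X : Polynomial ℝ) • N.map Polynomial.C +
    (1 : Matrix _ _ ℝ).map Polynomial.C).det, ?_, fun t => ?_⟩
  · simpa using Polynomial.natDegree_det_X_add_C_le N 1
  · rw [ContinuousLinearMap.det, ← LinearMap.det_toMatrix b, ← Polynomial.coe_evalRingHom,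
      RingHom.map_det]
    congr 1
    ext i j
    simp [hN, Matrix.one_apply, LinearMap.toMatrix_apply, Finsupp.single_apply]
    rw [apply_ite (Polynomial.eval t)]
    simp only [Polynomial.eval_one, Polynomial.eval_zero, eq_comm (a := i)]
    ring

/-- A perturbation of the identity with Lipschitz constant below one is bijective. It is the
identity outside the open ball, so it must permute the ball. -/
lemma image_ball_of_lipschitzWith {φ : E → E} {K : NNReal} (hφ : LipschitzWith K φ)
    (h0 : ∀ x, 1 ≤ ‖x‖ → φ x = 0) (hK : K < 1) :
    Function.Injective (fun x => x + φ x) ∧ (fun x => x + φ x) '' ball 0 1 = ball (0 : E) 1 := by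
  have happ : ApproximatesLinearOn (fun x => x + φ x)
      ((ContinuousLinearEquiv.refl ℝ E : E ≃L[ℝ] E) : E →L[ℝ] E) Set.univ K := by
    refine LipschitzOnWith.approximatesLinearOn ?_
    have : ((fun x => x + φ x) - ⇑((ContinuousLinearEquiv.refl ℝ E : E ≃L[ℝ] E) : E →L[ℝ] E)) = φ := by
      ext x; simp
    rw [this]
    exact hφ.lipschitzOnWith
  have hc : Subsingleton E ∨ K < ‖((ContinuousLinearEquiv.refl ℝ E).symm : E →L[ℝ] E)‖₊⁻¹ := by
    rcases subsingleton_or_nontrivial E with h | h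
    · exact Or.inl h
    · right
      have : ‖((ContinuousLinearEquiv.refl ℝ E).symm : E →L[ℝ] E)‖₊ = 1 := by
        rw [← NNReal.coe_inj]
        exact ContinuousLinearMap.norm_id
      rwa [this, inv_one]
  have hinj : Function.Injective (fun x => x + φ x) :=
    fun x y hxy => happ.injOn hc (Set.mem_univ x) (Set.mem_univ y) hxy
  have hsurj : Function.Surjective (fun x => x + φ x) := happ.surjective hc
  refine ⟨hinj, Set.Subset.antisymm ?_ fun y hy => ?_⟩
  · rintro _ ⟨x, hx, rfl⟩
    by_contra hcon
    rw [mem_ball_zero_iff, not_lt] at hcon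
    have : x + φ x = x := hinj (by simp [h0 _ hcon])
    rw [mem_ball_zero_iff] at hx
    simp only [this] at hcon
    exact hx.not_ge hcon
  · obtain ⟨x, rfl⟩ := hsurj y
    refine ⟨x, ?_, rfl⟩
    by_contra hcon
    rw [mem_ball_zero_iff, not_lt] at hcon
    simp only [h0 x hcon, add_zero] at hy
    rw [mem_ball_zero_iff] at hy
    exact hy.not_ge hcon

/-- Differentiating `‖g‖ ^ 2 = 1` shows that the derivative takes values orthogonal to the nonzero
vector `g x`, so it is not surjective. -/
lemma det_fderiv_eq_zero_of_norm_eq_one {g : E → E} {x : E} (hg : DifferentiableAt ℝ g x)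
    (h : ∀ᶠ y in nhds x, ‖g y‖ = 1) : (fderiv ℝ g x).det = 0 := by
  by_contra hdet
  have hzero : ∀ v, inner ℝ (g x) (fderiv ℝ g x v) = 0 := by
    intro v
    have h1 : HasFDerivAt (fun y => inner ℝ (g y) (g y)) _ x :=
      hg.hasFDerivAt.inner ℝ hg.hasFDerivAt
    have h2 : HasFDerivAt (fun y => inner ℝ (g y) (g y)) (0 : E →L[ℝ] ℝ) x :=
      (hasFDerivAt_const (1 : ℝ) x).congr_of_eventuallyEq
        (h.mono fun y hy => by simp [hy])
    have h3 := congrArg (fun L : E →L[ℝ] ℝ => L v) (h1.unique h2)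
    simpa [fderivInnerCLM_apply, real_inner_comm] using h3
  have hunit : IsUnit (fderiv ℝ g x : E →ₗ[ℝ] E) :=
    (LinearMap.isUnit_iff_isUnit_det _).2 (isUnit_iff_ne_zero.2 hdet)
  obtain ⟨v, hv⟩ := LinearMap.range_eq_top.1 ((LinearMap.isUnit_iff_range_eq_top _).1 hunit) (g x)
  have h4 := hzero v
  rw [ContinuousLinearMap.coe_coe] at hv
  rw [hv, real_inner_self_eq_norm_sq, h.self_of_nhds] at h4
  norm_num at h4

/-- The determinant of `id + t • A` is a polynomial in `t` of degree at most the dimension, so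
Lagrange interpolation at small nodes recovers its value at `1`. The weights do not depend on `A`,
so the identity can be integrated over the ball. -/
lemma exists_det_interpolation (δ : ℝ) (hδ : 0 < δ) :
    ∃ (s : Finset ℕ) (c v : ℕ → ℝ), (∀ j, 0 < v j ∧ v j ≤ δ) ∧ ∑ j ∈ s, c j = 1 ∧
      ∀ A : E →L[ℝ] E, (ContinuousLinearMap.id ℝ E + A).det =
        ∑ j ∈ s, c j * (ContinuousLinearMap.id ℝ E + v j • A).det := by
  set v : ℕ → ℝ := fun j => δ / (j + 1) with hv
  have hinj : Set.InjOn v (Finset.range (Module.finrank ℝ E + 1)) := by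
    intro i _ j _ hij
    simp only [hv] at hij
    rw [div_eq_div_iff (by positivity) (by positivity)] at hij
    have h : (j : ℝ) = i := by linarith [mul_left_cancel₀ hδ.ne' hij]
    exact_mod_cast h.symm
  obtain ⟨c, hc⟩ := exists_interpolation_weights hinj
  refine ⟨Finset.range (Module.finrank ℝ E + 1), c, v, fun j => ⟨by positivity, ?_⟩, ?_,
      fun A => ?_⟩
  · exact div_le_self hδ.le (by linarith [(Nat.cast_nonneg j : (0 : ℝ) ≤ j)])
  · have := hc 1 (by
      rw [Finset.card_range, Polynomial.degree_one]
      exact_mod_cast Nat.succ_pos _)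
    simpa using this.symm
  · obtain ⟨p, hp, hpe⟩ := exists_polynomial_det A
    have := hc p (by
      rw [Finset.card_range]
      exact Polynomial.degree_le_natDegree.trans_lt (by exact_mod_cast Nat.lt_succ_of_le hp))
    simpa only [hpe, one_smul] using this

/-- There is no differentiable retraction of the closed unit ball onto the unit sphere. -/
theorem not_exists_contDiff_retraction [MeasurableSpace E] [BorelSpace E] {g : E → E}
    (hg : ∀ x, ‖x‖ ≤ 1 → ContDiffAt ℝ 1 g x) (hnorm : ∀ x, ‖x‖ ≤ 1 → ‖g x‖ = 1)
    (hid : ∀ x, ‖x‖ = 1 → g x = x) : False := by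
  classical
  set A : E → E →L[ℝ] E := fun x => fderiv ℝ g x - ContinuousLinearMap.id ℝ E with hA
  have hAc : ContinuousOn A (closedBall 0 1) := fun x hx => by
    have h1 : ContDiffAt ℝ 0 (fderiv ℝ g) x :=
      (hg x (by simpa using hx)).fderiv_right (by norm_num)
    exact (h1.continuousAt.sub continuousAt_const).continuousWithinAt
  obtain ⟨C, hC⟩ := (isCompact_closedBall (0 : E) 1).exists_bound_of_continuousOn hAc
  set K : NNReal := C.toNNReal with hK
  have hAK : ∀ x, ‖x‖ ≤ 1 → ‖A x‖ ≤ K := fun x hx =>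
    (hC x (by simpa using hx)).trans (Real.le_coe_toNNReal C)
  set φ : E → E := fun x => if ‖x‖ ≤ 1 then g x - x else 0 with hφ
  have hφ0 : ∀ x, 1 ≤ ‖x‖ → φ x = 0 := fun x hx => by
    simp only [hφ]
    split_ifs with h
    · rw [hid x (le_antisymm h hx), sub_self]
    · rfl
  have hgd : ∀ x, ‖x‖ ≤ 1 → HasFDerivAt (fun y => g y - y) (A x) x := fun x hx =>
    ((hg x hx).differentiableAt (by norm_num)).hasFDerivAt.sub (hasFDerivAt_id x)
  have hφL : LipschitzWith K φ := by
    refine lipschitzWith_of_eq_zero ?_ hφ0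
    have h1 : LipschitzOnWith K (fun y => g y - y) (closedBall 0 1) :=
      (convex_closedBall (0 : E) 1).lipschitzOnWith_of_nnnorm_hasFDerivWithin_le
        (fun x hx => (hgd x (by simpa using hx)).hasFDerivWithinAt)
        fun x hx => hAK x (by simpa using hx)
    intro x hx y hy
    simp only [hφ]
    rw [if_pos (by simpa using hx), if_pos (by simpa using hy)]
    exact h1 hx hy
  obtain ⟨ε, hε, hdet⟩ : ∃ ε > 0, ∀ N : E →L[ℝ] E, ‖N‖ < ε →
      0 < (ContinuousLinearMap.id ℝ E + N).det := by
    have hcont : Continuous fun N : E →L[ℝ] E => (ContinuousLinearMap.id ℝ E + N).det :=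
      ContinuousLinearMap.continuous_det.comp (continuous_const.add continuous_id)
    have h0 : 0 < (ContinuousLinearMap.id ℝ E + (0 : E →L[ℝ] E)).det := by
      simp [ContinuousLinearMap.det]
    obtain ⟨ε, hε, h⟩ :=
        Metric.eventually_nhds_iff.1 (hcont.continuousAt.eventually (lt_mem_nhds h0))
    exact ⟨ε, hε, fun N hN => h (by simpa using hN)⟩
  -- For `t ≤ δ` this gives `t * K < 1`, for bijectivity, and `t * K < ε`, for a positive Jacobian.
  -- The `K + 1` covers `K = 0`.
  set δ : ℝ := min 1 ε / (2 * (K + 1)) with hδ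
  have hδ0 : 0 < δ := by positivity
  have hδK : ∀ t, 0 < t → t ≤ δ → t * K < min 1 ε := fun t ht htδ => by
    have hm : 0 < min 1 ε := by positivity
    have hK0 : (0 : ℝ) ≤ K := K.2
    calc t * K ≤ δ * (K + 1) := by gcongr; linarith
      _ = min 1 ε / 2 := by rw [hδ]; field_simp
      _ < min 1 ε := by linarith
  have hvol : ∀ t, 0 < t → t ≤ δ → ∫ x in ball (0 : E) 1,
      (ContinuousLinearMap.id ℝ E + t • A x).det =
      (volume : Measure E).real (ball 0 1) := by
    intro t ht htδ
    have htK := hδK t ht htδ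
    have hL : LipschitzWith (t.toNNReal * K) fun x => t • φ x := by
      refine LipschitzWith.of_dist_le_mul fun x y => ?_
      rw [dist_smul₀, Real.norm_of_nonneg ht.le, NNReal.coe_mul, Real.coe_toNNReal _ ht.le,
          mul_assoc]
      gcongr
      exact hφL.dist_le_mul x y
    obtain ⟨hinj, himg⟩ := image_ball_of_lipschitzWith hL (fun x hx => by rw [hφ0 x hx, smul_zero])
      (by
        rw [← NNReal.coe_lt_coe, NNReal.coe_mul, Real.coe_toNNReal _ ht.le]
        exact htK.trans_le (min_le_left _ _))
    have hd : ∀ x ∈ ball (0 : E) 1, HasFDerivWithinAt (fun x => x + t • φ x)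
        (ContinuousLinearMap.id ℝ E + t • A x) (ball 0 1) x := fun x hx => by
      have h1 := (hasFDerivAt_id (𝕜 := ℝ) x).add
        ((hgd x (by simpa using (mem_ball_zero_iff.1 hx).le)).const_smul t)
      refine h1.hasFDerivWithinAt.congr (fun y hy => ?_) ?_
      · simp [hφ, (mem_ball_zero_iff.1 hy).le]
      · simp [hφ, (mem_ball_zero_iff.1 hx).le]
    have h2 :=
        integral_image_eq_integral_abs_det_fderiv_smul (volume : Measure E) measurableSet_ball hd
      hinj.injOn fun _ => (1 : ℝ)
    rw [himg] at h2
    simp only [smul_eq_mul, mul_one, integral_const, measureReal_restrict_apply_univ] at h2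
    rw [h2]
    refine setIntegral_congr_fun measurableSet_ball fun x hx => ?_
    refine (abs_of_pos (hdet _ ?_)).symm
    rw [norm_smul, Real.norm_of_nonneg ht.le]
    refine lt_of_le_of_lt ?_ (htK.trans_le (min_le_right _ _))
    gcongr
    exact hAK x (mem_ball_zero_iff.1 hx).le
  obtain ⟨s, c, v, hv, hc, hint⟩ := exists_det_interpolation (E := E) δ hδ0
  have hintegrable : ∀ t : ℝ,
      IntegrableOn (fun x => (ContinuousLinearMap.id ℝ E + t • A x).det) (ball (0 : E) 1) volume :=
    fun t => by
    refine IntegrableOn.mono_set (ContinuousOn.integrableOn_compact (isCompact_closedBall 0 1) ?_)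
      ball_subset_closedBall
    exact ContinuousLinearMap.continuous_det.comp_continuousOn
      (continuousOn_const.add (hAc.const_smul t))
  -- Interpolation carries the volume identity from small `t` to `t = 1`, where the integrand is the
  -- vanishing Jacobian of `g`.
  have hone : ∫ x in ball (0 : E) 1, (ContinuousLinearMap.id ℝ E + A x).det =
      (volume : Measure E).real (ball 0 1) := by
    rw [setIntegral_congr_fun measurableSet_ball fun x _ => hint (A x),
        integral_finsetSum _ fun j _ => (hintegrable (v j)).const_mul (c j)]
    simp only [integral_const_mul]
    rw [Finset.sum_congr rfl fun j _ => by rw [hvol (v j) (hv j).1 (hv j).2], ← Finset.sum_mul, hc,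
      one_mul]
  have hzero : ∫ x in ball (0 : E) 1, (ContinuousLinearMap.id ℝ E + A x).det = 0 := by
    rw [setIntegral_congr_fun measurableSet_ball (g := fun _ => (0 : ℝ)), integral_zero]
    intro x hx
    have hx' := mem_ball_zero_iff.1 hx
    simp only [hA, add_sub_cancel]
    refine det_fderiv_eq_zero_of_norm_eq_one ((hg x hx'.le).differentiableAt (by norm_num)) ?_
    filter_upwards [isOpen_ball.mem_nhds hx] with y hy
    exact hnorm y (mem_ball_zero_iff.1 hy).le
  have hpos : 0 < (volume : Measure E).real (ball 0 1) :=
    ENNReal.toReal_pos (measure_ball_pos _ _ one_pos).ne' measure_ball_lt_top.ne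
  rw [hone] at hzero
  exact hpos.ne' hzero

open Manifold in
lemma exists_contDiff_norm_sub_lt {q : E → E} (hq : Continuous q) {ε : ℝ} (hε : 0 < ε) :
    ∃ p : E → E, ContDiff ℝ 1 p ∧ ∀ x, ‖p x - q x‖ < ε := by
  obtain ⟨p, hp⟩ := exists_contMDiffMap_forall_mem_convex_of_local_const (n := 1) (𝓘(ℝ, E))
    (t := fun x => ball (q x) ε) (fun x => convex_ball _ _) fun x => ⟨q x, by
      have : ∀ᶠ y in nhds x, dist (q y) (q x) < ε :=
        hq.continuousAt.eventually (ball_mem_nhds _ hε)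
      exact this.mono fun y hy => by rwa [mem_ball, dist_comm]⟩
  exact ⟨p, p.contMDiff.contDiff, fun x => by simpa [dist_eq_norm] using hp x⟩

/-- There is no retraction of Euclidean space onto its unit sphere. -/
theorem not_exists_retraction_sphere [MeasurableSpace E] [BorelSpace E] {ρ : E →
    E} (hρ : Continuous ρ)
    (hnorm : ∀ x, ‖ρ x‖ = 1) (hid : ∀ x, ‖x‖ = 1 → ρ x = x) : False := by
  -- The map `-ρ` has no fixed point in the ball: such a point would lie on the sphere and satisfy
  -- `x = -x`. Compactness makes this quantitative.
  obtain ⟨η, hη, hηle⟩ : ∃ η > 0, ∀ x, ‖x‖ ≤ 1 → η ≤ ‖x + ρ x‖ := by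
    obtain ⟨x₀, hx₀, hmin⟩ := (isCompact_closedBall (0 : E) 1).exists_isMinOn
      ⟨0, by simp⟩ (f := fun x => ‖x + ρ x‖) (by fun_prop)
    refine ⟨‖x₀ + ρ x₀‖, norm_pos_iff.2 fun h => ?_, fun x hx => hmin (by simpa using hx)⟩
    have h1 : x₀ = -ρ x₀ := eq_neg_of_add_eq_zero_left h
    have h2 : ‖x₀‖ = 1 := by rw [h1, norm_neg, hnorm]
    rw [hid x₀ h2, ← two_smul ℝ, smul_eq_zero] at h
    rcases h with h | h
    · norm_num at h
    · rw [h, norm_zero] at h2; norm_num at h2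
  set ε : ℝ := min η 1 / 4 with hε
  have hε0 : 0 < ε := by positivity
  have hεη : 4 * ε ≤ η := by rw [hε]; linarith [min_le_left η 1]
  have hε1 : 4 * ε ≤ 1 := by rw [hε]; linarith [min_le_right η 1]
  -- Shrinking `-ρ` by `1 - 2 * ε` keeps the approximation `p` inside the open unit ball. The total
  -- error `3 * ε` stays below `η`, so `p` has no fixed point in the ball.
  obtain ⟨p, hp, hpq⟩ := exists_contDiff_norm_sub_lt (q := fun x => -((1 - 2 * ε) • ρ x))
    (by fun_prop) hε0
  have hp1 : ∀ x, ‖p x‖ < 1 := fun x => by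
    have h1 := norm_le_norm_add_norm_sub' (p x) (-((1 - 2 * ε) • ρ x))
    rw [norm_neg, norm_smul, hnorm, Real.norm_of_nonneg (by linarith)] at h1
    linarith [hpq x]
  have hfix : ∀ x, ‖x‖ ≤ 1 → x - p x ≠ 0 := fun x hx h => by
    have e : x + ρ x = (x - p x) + (p x - -((1 - 2 * ε) • ρ x)) + (2 * ε) • ρ x := by
      module
    have h1 := hηle x hx
    rw [e, h, zero_add] at h1
    have h2 := norm_add_le (p x - -((1 - 2 * ε) • ρ x)) ((2 * ε) • ρ x)
    rw [norm_smul, hnorm, Real.norm_of_nonneg (by linarith)] at h2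
    linarith [hpq x]
  set D : E → ℝ := fun x => inner ℝ x (x - p x) ^ 2 + ‖x - p x‖ ^ 2 * (1 - ‖x‖ ^ 2) with hD
  have hinner : ∀ x, ‖x‖ = 1 → 0 < inner ℝ x (x - p x) := fun x hx => by
    rw [inner_sub_right, real_inner_self_eq_norm_sq, hx]
    have := real_inner_le_norm x (p x)
    rw [hx, one_mul] at this
    linarith [hp1 x]
  have hDpos : ∀ x, ‖x‖ ≤ 1 → 0 < D x := fun x hx => by
    rcases hx.lt_or_eq with h | h
    · have h1 : 0 < ‖x - p x‖ := norm_pos_iff.2 (hfix x hx)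
      have h2 : 0 < 1 - ‖x‖ ^ 2 := by nlinarith [norm_nonneg x]
      simp only [hD]
      positivity
    · have := hinner x h
      simp only [hD, h]
      positivity
  -- The ray from `p x` through `x` is followed to the sphere. The coefficient is the larger root of
  -- the quadratic `‖x + t • (x - p x)‖ ^ 2 = 1`, and `D` is a quarter of its discriminant.
  set g : E → E := fun x =>
    x + ((-inner ℝ x (x - p x) + √(D x)) / ‖x - p x‖ ^ 2) • (x - p x) with hg
  refine not_exists_contDiff_retraction (g := g) (fun x hx => ?_) (fun x hx => ?_) fun x hx => ?_
  · have hpx : ContDiffAt ℝ 1 p x := hp.contDiffAt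
    have hu : ContDiffAt ℝ 1 (fun x => x - p x) x := contDiffAt_id.sub hpx
    have hi : ContDiffAt ℝ 1 (fun x => inner ℝ x (x - p x)) x := contDiffAt_id.inner ℝ hu
    have hn : ContDiffAt ℝ 1 (fun x => ‖x - p x‖ ^ 2) x := hu.norm_sq ℝ
    have hn' : ContDiffAt ℝ 1 (fun x : E => ‖x‖ ^ 2) x := contDiffAt_id.norm_sq ℝ
    have hDc : ContDiffAt ℝ 1 D x := (hi.pow 2).add (hn.mul (contDiffAt_const.sub hn'))
    exact contDiffAt_id.add (((hi.neg.add (hDc.sqrt (hDpos x hx).ne')).div hn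
      (pow_ne_zero 2 (norm_ne_zero_iff.2 (hfix x hx)))).smul hu)
  · have hu : ‖x - p x‖ ^ 2 ≠ 0 := pow_ne_zero 2 (norm_ne_zero_iff.2 (hfix x hx))
    have hsq : √(D x) ^ 2 = D x := Real.sq_sqrt (hDpos x hx).le
    have h1 : ‖g x‖ ^ 2 = 1 := by
      simp only [hg]
      rw [norm_add_sq_real, inner_smul_right, norm_smul, mul_pow, Real.norm_eq_abs, sq_abs]
      have hDx : D x = inner ℝ x (x - p x) ^ 2 + ‖x - p x‖ ^ 2 * (1 - ‖x‖ ^ 2) := rfl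
      rw [hDx] at hsq
      rw [hDx]
      generalize ‖x - p x‖ ^ 2 = N at *
      generalize √(inner ℝ x (x - p x) ^ 2 + N * (1 - ‖x‖ ^ 2)) = r at *
      field_simp
      linear_combination hsq
    nlinarith [norm_nonneg (g x)]
  · have h1 : √(D x) = inner ℝ x (x - p x) := by
      simp only [hD, hx]
      norm_num
      exact Real.sqrt_sq (hinner x hx).le
    simp [hg, h1]

end NoRetraction

/-! ### Absolute extensors are not spheres. -/

namespace SimpComplex

/-- A complex whose realization is an absolute extensor is not spherical. -/
theorem not_isSpherical_of_isAbsExtensor {V : Type*} [Fintype V] [DecidableEq V]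
    {Δ : LowerSet (Finset V)}
    (h : ∀ n : ℕ, IsAbsExtensor (EuclideanSpace ℝ (Fin n)) (realization Δ)) : ¬ IsSpherical Δ := by
  classical
  rintro ⟨n, ⟨e⟩⟩
  set S := Metric.sphere (0 : EuclideanSpace ℝ (Fin n)) 1 with hS
  set f : EuclideanSpace ℝ (Fin n) → V → ℝ := fun y =>
    if hy : y ∈ S then (e.symm ⟨y, hy⟩ : V → ℝ) else 0 with hf
  have hfS : ∀ (y) (hy : y ∈ S), f y = e.symm ⟨y, hy⟩ := fun y hy => dif_pos hy
  have hfc : ContinuousOn f S := by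
    rw [continuousOn_iff_continuous_domRestrict]
    have : S.domRestrict f = fun y => (e.symm y : V → ℝ) := funext fun y => hfS y y.2
    rw [this]
    exact continuous_subtype_val.comp e.symm.continuous
  -- Extending the inverse homeomorphism to all of Euclidean space and composing with `e` gives a
  -- retraction onto the sphere.
  obtain ⟨g, hg, hgm, hge⟩ := h n S Metric.isClosed_sphere f hfc fun y hy => by
    rw [hfS y hy]; exact (e.symm ⟨y, hy⟩).2
  refine not_exists_retraction_sphere (ρ := fun y => (e ⟨g y, hgm y⟩ : EuclideanSpace ℝ (Fin n)))
    (continuous_subtype_val.comp (e.continuous.comp (hg.subtype_mk hgm)))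
    (fun y => by simp) fun y hy => ?_
  have hyS : y ∈ S := by simpa [hS] using hy
  have h1 : (⟨g y, hgm y⟩ : realization Δ) = e.symm ⟨y, hyS⟩ :=
    Subtype.ext ((hge hyS).trans (hfS y hyS))
  simp only [h1, Homeomorph.apply_symm_apply]

end SimpComplex

/-! ### Subword complexes as factorization complexes, and the conclusion. -/

namespace SubwordComplex

open SimpComplex

variable {B W V : Type*} [Group W] {M : CoxeterMatrix B} {cs : CoxeterSystem M W} {Q : V → B}
  {A C : List V} {w : W}

lemma IsFactorization.append {a c : List V} (h : IsFactorization cs Q A 1 C w a c) :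
    IsReducedSubword cs Q (A ++ C) w (a ++ c) where
  sublist := h.left.append h.right
  prod_eq := by
    rw [List.map_append, cs.wordProd_append, ← h.prod_eq, mul_one]
  length_eq := by
    rw [List.length_append, ← h.length_eq, cs.length_one, add_zero]

lemma IsReducedSubword.exists_isFactorization {d : List V}
    (h : IsReducedSubword cs Q (A ++ C) w d) :
    ∃ a c, d = a ++ c ∧ IsFactorization cs Q A 1 C w a c := by
  obtain ⟨a, c, rfl, ha, hc⟩ := List.sublist_append_iff.1 h.sublist
  refine ⟨a, c, rfl, ha, hc, ?_, ?_⟩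
  · rw [← h.prod_eq, List.map_append, cs.wordProd_append, mul_one]
  · rw [← h.length_eq, List.length_append, cs.length_one, add_zero]

lemma factorizationComplex_append [DecidableEq V] :
    factorizationComplex cs Q [] 1 (A ++ C) w = factorizationComplex cs Q A 1 C w := by
  ext J
  rw [SetLike.mem_coe, SetLike.mem_coe, mem_factorizationComplex_nil_one, mem_factorizationComplex]
  refine and_congr_right fun _ => ⟨?_, ?_⟩
  · rintro ⟨d, hd, hav⟩
    obtain ⟨a, c, rfl, h⟩ := hd.exists_isFactorization
    exact ⟨a, c, h, fun v hv => by simpa using hav v hv⟩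
  · rintro ⟨a, c, h, hav⟩
    exact ⟨a ++ c, h.append, fun v hv => by simpa using hav v hv⟩

lemma _root_.List.Sublist.filter_mem_toFinset [DecidableEq V] {c L : List V} (h : c.Sublist L)
    (hL : L.Nodup) : L.filter (fun k => k ∈ c.toFinset) = c := by
  have h1 : c.Sublist (L.filter (fun k => k ∈ c.toFinset)) := by
    have := h.filter (fun k => decide (k ∈ c.toFinset))
    rwa [List.filter_eq_self.2 fun k hk => by simpa using hk] at this
  refine (h1.eq_of_length ?_).symm
  rw [← List.toFinset_card_of_nodup (hL.sublist h), ← List.toFinset_card_of_nodup (hL.filter _)]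
  congr 1
  ext k
  simpa using fun hk => h.subset hk

lemma subwordComplex_eq_factorizationComplex {r : ℕ} (Q : Fin r → B) (w : W) :
    subwordComplex cs Q w = factorizationComplex cs Q [] 1 (List.finRange r) w := by
  ext J
  rw [SetLike.mem_coe, SetLike.mem_coe, mem_factorizationComplex_nil_one]
  constructor
  · rintro ⟨I, hJI, hprod, hred⟩
    refine ⟨fun u _ => by simp, (List.finRange r).filter (fun k => k ∈ Iᶜ),
      ⟨List.filter_sublist, hprod, ?_⟩, fun v hv => ?_⟩
    · rw [← hprod, hred.eq, subwordAt, List.length_map]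
    · simpa using hJI hv
  · rintro ⟨-, c, hc, hav⟩
    have hsub : subwordAt Q c.toFinsetᶜᶜ = c.map Q := by
      rw [compl_compl, subwordAt, hc.sublist.filter_mem_toFinset (List.nodup_finRange r)]
    refine ⟨c.toFinsetᶜ, fun v hv => by simpa using hav v hv, ?_⟩
    rw [hsub]
    refine ⟨hc.prod_eq, ?_⟩
    rw [CoxeterSystem.IsReduced, hc.prod_eq, List.length_map, hc.length_eq]

/-- In a spherical subword complex the deletion of a vertex is vertex decomposable. -/
theorem vertexDecomposable_deletion_of_isSpherical {r : ℕ} (Q : Fin r → B) (w : W)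
    (hsph : IsSpherical (subwordComplex cs Q w)) {i : Fin r} (hi : {i} ∈ subwordComplex cs Q w) :
    VertexDecomposable (deletion (subwordComplex cs Q w) {i}) := by
  rw [subwordComplex_eq_factorizationComplex] at *
  have hnd := List.nodup_finRange r
  have hmax : ∀ w' c, IsReducedSubword cs Q (List.finRange r) w' c → cs.length w' ≤ cs.length w :=
      by
    by_contra! hcon
    obtain ⟨w', c', hc', hlt⟩ := hcon
    obtain ⟨-, c, hc, -⟩ := mem_factorizationComplex_nil_one.1 hi
    refine not_isSpherical_of_isAbsExtensor (fun n => ?_) hsph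
    rw [realization_eq_barycentric]
    exact isAbsExtensor_factorizationComplex _ w hnd ⟨c, hc⟩ ⟨w', c', hc', hlt⟩
  obtain ⟨A, C, hAC⟩ := List.append_of_mem (List.mem_finRange i)
  rw [hAC] at hnd hmax hi ⊢
  rw [factorizationComplex_append] at hi ⊢
  have hdel : ∅ ∈ deletion (factorizationComplex cs Q A 1 (i :: C) w) {i} :=
    ⟨LowerSet.lower _ (Finset.empty_subset {i}) hi, by simp⟩
  -- With middle element `1` every letter is an ascent, so `Q` may be split at any vertex `i`.
  have hasc : cs.length (1 : W) < cs.length (1 * cs.simple (Q i)) := by simp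
  have H : ∀ w' a c, IsFactorization cs Q A 1 (i :: C) w' a c → cs.length w' ≤ cs.length w :=
    fun w' a c h => hmax w' _ h.append
  rw [deletion_factorizationComplex_of_ascent hnd hasc H] at hdel ⊢
  exact vertexDecomposable_factorizationComplex (List.nodup_cons.1 (List.nodup_middle.1 hnd)).2 hdel
    fun w' a c h => H w' a (i :: c) (IsFactorization.cons hasc rfl h)

end SubwordComplex

theorem mainTheorem6 {B W : Type*} [Group W] [Finite W] {M : CoxeterMatrix B}
    (cs : CoxeterSystem M W) {r : ℕ} (Q : Fin r → B) (w : W)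
    (hsph : SimpComplex.IsSpherical (subwordComplex cs Q w))
    (i : Fin r) (hi : {i} ∈ subwordComplex cs Q w) :
    SimpComplex.VertexDecomposable (SimpComplex.deletion (subwordComplex cs Q w) {i}) :=
  SubwordComplex.vertexDecomposable_deletion_of_isSpherical Q w hsph hi
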